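/- **Setting.** Let $\mathcal X$ be a compact space with its Borel $\sigma$-algebra, and let $\mathcal H$ be a (real) reproducing kernel Hilbert space on $\mathcal X$ with measurable kernel $K(x,x')=\langle\Phi(x),\Phi(x')\rangle_{\mathcal H}$, whose canonical feature map $\Phi$ satisfies $\|\Phi(x)\|_{\mathcal H}\le R<\infty$ for all $x$. Let $P_{tr},P_{te}$ be probability measures on $\mathcal X$ (the covariate laws) with $P_{te}\ll P_{tr}$ and $\beta=\frac{dP_{te}}{dP_{tr}}\le B<\infty$ ($P_{tr}$-a.e.). Let the conditional law $P(dy\mid x)$ of the label $Y\in[0,1]$ given $x$ be the same for training and test data, put $g(x)=\mathbb E[Y\mid x]$ and $\nu=\mathbb E[Y^{te}]=\mathbb E_{x\sim P_{te}}[g(x)]$. Let $(\mathcal T_Kf)(x')=\int K(x',x)f(x)\,P_{tr}(dx)$ on $\mathscr L^2_{P_{tr}}$, and assume $g\in\mathrm{Range}\bigl(\mathcal T_K^{\theta/(2\theta+4)}\bigr)$ for some $\theta>0$. Observe $n_{tr}$ i.i.d. labelled training points $(x^{tr}_j,y^{tr}_j)\sim P_{tr}(dx)P(dy\mid x)$ and,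 independently, $n_{te}$ i.i.d. unlabelled test points $x^{te}_i\sim P_{te}$. Fix $\rho\in(0,1)$, let $k=\lfloor\rho n_{tr}\rfloor\ge1$, $m=n_{tr}-k$, $n_{te}\ge 1$. Let $\hat\beta\in[0,B]^k$ be a minimizer (selected measurably from $x^{tr}_1,\dots,x^{tr}_k,x^{te}_1,\dots,x^{te}_{n_{te}}$) of $$\Bigl\|\frac1k\sum_{j=1}^k\hat\beta_j\Phi(x^{tr}_j)-\frac1{n_{te}}\sum_{i=1}^{n_{te}}\Phi(x^{te}_i)\Bigr\|_{\mathcal H}^2 \quad\text{over } [0,B]^k,$$ let, for $\gamma>0$, $$\hat g=\operatorname*{argmin}_{f\in\mathcal H}\Bigl\{\frac1m\sum_{j=k+1}^{n_{tr}}(f(x^{tr}_j)-y^{tr}_j)^2+\gamma\|f\|_{\mathcal H}^2\Bigr\},$$ and put $$V_R(\rho)=\frac1k\sum_{j=1}^k\hat\beta_j\,\bigl(y^{tr}_j-\hat g(x^{tr}_j)\bigr)+\frac1{n_{te}}\sum_{i=1}^{n_{te}}\hat g(x^{te}_i).$$ **Claim.** Let $n=\min(n_{tr},n_{te})$. 1.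 If $\gamma=n^{-1}$, then $|V_R(\rho)-\nu|=\mathcal O\bigl(n_{tr}^{-\theta/(2\theta+4)}+n_{te}^{-\theta/(2\theta+4)}\bigr)$. 2. If $\gamma=n_{tr}^{-1}$, then $|V_R(\rho)-\nu|=\mathcal O\bigl(n_{tr}^{-\theta/(2\theta+4)}+n_{te}^{-1/2}\bigr)$. Here $|V_R(\rho)-\nu|=\mathcal O(r(n_{tr},n_{te}))$ is meant in both of the following senses, with constants that do not depend on $n_{tr},n_{te}$: there is $C$ with $\mathbb E|V_R(\rho)-\nu|\le C\,r(n_{tr},n_{te})$ for all $n_{tr},n_{te}$ as above; and for every $\delta\in(0,1)$ there is $C_\delta$ such that $|V_R(\rho)-\nu|\le C_\delta\,r(n_{tr},n_{te})$ with probability at least $1-\delta$ for all such $n_{tr},n_{te}$. -/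

import Mathlib

open MeasureTheory ProbabilityTheory Set
open scoped ENNReal

namespace CovariateShift

noncomputable section

section RKHSBasics

variable {X : Type*} (H : Type*) [NormedAddCommGroup H] [InnerProductSpace ℝ H] [CompleteSpace H]
  [RKHS ℝ H X ℝ]

/-- The canonical feature map `Φ : X → H`, so that `f x = ⟪f, Φ x⟫` for `f : H`. -/
def featureMap (x : X) : H := RKHS.kerFun H x (1 : ℝ)

/-- The reproducing kernel `K x x' = ⟪Φ x, Φ x'⟫`. -/
def kernelFun (x x' : X) : ℝ := inner ℝ (featureMap H x) (featureMap H x')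

lemma abs_kernelFun_le {R : ℝ} (hR : ∀ x : X, ‖featureMap H x‖ ≤ R) (x x' : X) :
    |kernelFun H x x'| ≤ R * R :=
  (abs_real_inner_le_norm _ _).trans
    (mul_le_mul (hR x) (hR x') (norm_nonneg _) ((norm_nonneg _).trans (hR x)))

end RKHSBasics

section IntegralOperator

variable {X : Type*} [MeasurableSpace X]

lemma integrable_kernel_mul {K : X → X → ℝ} (hK : Measurable (Function.uncurry K)) {M : ℝ}
    (hM : ∀ x x', |K x x'| ≤ M) (μ : Measure X) [IsFiniteMeasure μ] (f : Lp ℝ 2 μ) (x' : X) :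
    Integrable (fun x => K x' x * f x) μ :=
  ((Lp.memLp f).integrable (by norm_num)).bdd_mul
    (hK.comp measurable_prodMk_left).aestronglyMeasurable
    (Filter.Eventually.of_forall fun x => hM x' x)

lemma memLp_kernel_integral {K : X → X → ℝ} (hK : Measurable (Function.uncurry K)) {M : ℝ}
    (hM : ∀ x x', |K x x'| ≤ M) (μ : Measure X) [IsFiniteMeasure μ] (f : Lp ℝ 2 μ) :
    MemLp (fun x' => ∫ x, K x' x * f x ∂μ) 2 μ := by
  have hf : StronglyMeasurable (f : X → ℝ) := Lp.stronglyMeasurable f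
  have hm : StronglyMeasurable (fun x' => ∫ x, K x' x * f x ∂μ) := by
    apply StronglyMeasurable.integral_prod_right'
      (f := fun p : X × X => K p.1 p.2 * f p.2)
    exact (hK.stronglyMeasurable).mul (hf.comp_measurable measurable_snd)
  refine MemLp.of_bound hm.aestronglyMeasurable (M * ∫ x, ‖f x‖ ∂μ)
    (Filter.Eventually.of_forall fun x' => ?_)
  have hfi : Integrable (f : X → ℝ) μ := (Lp.memLp f).integrable (by norm_num)
  calc ‖∫ x, K x' x * f x ∂μ‖ ≤ ∫ x, M * ‖f x‖ ∂μ := by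
        refine norm_integral_le_of_norm_le (hfi.norm.const_mul M)
          (Filter.Eventually.of_forall fun x => ?_)
        rw [norm_mul]
        exact mul_le_mul_of_nonneg_right (hM x' x) (norm_nonneg _)
    _ = M * ∫ x, ‖f x‖ ∂μ := integral_const_mul _ _

/-- The integral operator `(T_K f)(x') = ∫ K(x', x) f(x) μ(dx)` as a linear map on `L²(μ)`. -/
def integralOperator {K : X → X → ℝ} (hK : Measurable (Function.uncurry K)) {M : ℝ}
    (hM : ∀ x x', |K x x'| ≤ M) (μ : Measure X) [IsFiniteMeasure μ] :
    Lp ℝ 2 μ →ₗ[ℝ] Lp ℝ 2 μ where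
  toFun f := (memLp_kernel_integral hK hM μ f).toLp _
  map_add' f g := by
    rw [← MemLp.toLp_add]
    refine MemLp.toLp_congr _ _ (Filter.Eventually.of_forall fun x' => ?_)
    simp only [Pi.add_apply]
    rw [← integral_add (integrable_kernel_mul hK hM μ f x') (integrable_kernel_mul hK hM μ g x')]
    refine integral_congr_ae ?_
    filter_upwards [Lp.coeFn_add f g] with x hx
    rw [hx, Pi.add_apply, mul_add]
  map_smul' c f := by
    rw [RingHom.id_apply, ← MemLp.toLp_const_smul]
    refine MemLp.toLp_congr _ _ (Filter.Eventually.of_forall fun x' => ?_)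
    simp only [Pi.smul_apply, smul_eq_mul]
    rw [← integral_const_mul]
    refine integral_congr_ae ?_
    filter_upwards [Lp.coeFn_smul c f] with x hx
    rw [hx, Pi.smul_apply, smul_eq_mul]
    ring

end IntegralOperator

section FractionalPower

variable {E : Type*} [NormedAddCommGroup E] [InnerProductSpace ℝ E]

/-- `g = T ^ r u` for a diagonalizable positive operator `T` and `r > 0`: writing `u = ∑ v_lam` with
`v_lam` in the eigenspace of `T` for `lam`, one has `T ^ r u = ∑ lam ^ r • v_lam`.  The sums run over
all reals `lam`; only eigenvalues contribute, the other eigenspaces being zero. -/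
def IsFracPow (T : E →ₗ[ℝ] E) (r : ℝ) (u g : E) : Prop :=
  ∃ v : ℝ → E, (∀ lam, v lam ∈ Module.End.eigenspace T lam) ∧ HasSum v u ∧
    HasSum (fun lam => lam ^ r • v lam) g

/-- The range of `T ^ r`. -/
def fracPowRange (T : E →ₗ[ℝ] E) (r : ℝ) : Set E := {g | ∃ u, IsFracPow T r u g}

end FractionalPower

section Estimator

variable {X : Type*} (H : Type*) [NormedAddCommGroup H] [InnerProductSpace ℝ H] [CompleteSpace H]
  [RKHS ℝ H X ℝ]

/-- The kernel mean matching objective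
`‖(1/k) ∑ b_j Φ(x_j) - (1/l) ∑ Φ(z_i)‖²` for training covariates `x` and test covariates `z`. -/
def kmmObjective {k l : ℕ} (x : Fin k → X) (z : Fin l → X) (b : Fin k → ℝ) : ℝ :=
  ‖(1 / (k : ℝ)) • ∑ j, b j • featureMap H (x j) - (1 / (l : ℝ)) • ∑ i, featureMap H (z i)‖ ^ 2

/-- `b` is an optimal solution of the kernel mean matching program with box constraints
`0 ≤ b_j ≤ B`. -/
def IsKMMWeights (B : ℝ) {k l : ℕ} (x : Fin k → X) (z : Fin l → X) (b : Fin k → ℝ) : Prop :=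
  (∀ j, b j ∈ Icc 0 B) ∧
    IsMinOn (kmmObjective H x z) {b' : Fin k → ℝ | ∀ j, b' j ∈ Icc 0 B} b

/-- A solver of the kernel mean matching program: a measurable selection of an optimal solution from
the covariates (the optimal solution need not be unique). -/
def IsKMMSolver [MeasurableSpace X] (B : ℝ) {k l : ℕ}
    (bhat : (Fin k → X) × (Fin l → X) → Fin k → ℝ) : Prop :=
  Measurable bhat ∧ ∀ x z, IsKMMWeights H B x z (bhat (x, z))

variable {H}

/-- `f` minimizes the regularized empirical squared loss
`(1/m) ∑ (f(x_j) - y_j)² + gam ‖f‖²` over the whole space `H`. -/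
def IsRegularizedLS (gam : ℝ) {m : ℕ} (d : Fin m → X × ℝ) (f : H) : Prop :=
  IsMinOn (fun f : H => (1 / (m : ℝ)) * ∑ j, (f (d j).1 - (d j).2) ^ 2 + gam * ‖f‖ ^ 2) univ f

/-- The first `⌊ρ n⌋` data points. -/
def firstPart {α : Type*} {ρ : ℝ} (hρ : ρ ≤ 1) {n : ℕ} (d : Fin n → α) : Fin ⌊ρ * n⌋₊ → α :=
  fun j => d ⟨j, j.2.trans_le
    (Nat.floor_le_of_le (mul_le_of_le_one_left (Nat.cast_nonneg n) hρ))⟩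

/-- The remaining data points, from index `⌊ρ n⌋ + 1` to `n` (counting from `1`). -/
def secondPart {α : Type*} (ρ : ℝ) {n : ℕ} (d : Fin n → α) : Fin (n - ⌊ρ * n⌋₊) → α :=
  fun j => d ⟨⌊ρ * n⌋₊ + j, Nat.add_lt_of_lt_sub' j.2⟩

/-- The robust estimator `V_R(ρ)`, evaluated on the sample `s` of labelled training data and
unlabelled test data.  The weights use the covariates of the first part of the training data and the
test data, the regression function uses the second part of the training data. -/
def robustEstimator {ρ : ℝ} (hρ : ρ ≤ 1) {ntr nte : ℕ}
    (bhat : (Fin ⌊ρ * ntr⌋₊ → X) × (Fin nte → X) → Fin ⌊ρ * ntr⌋₊ → ℝ)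
    (ghat : (Fin (ntr - ⌊ρ * ntr⌋₊) → X × ℝ) → H)
    (s : (Fin ntr → X × ℝ) × (Fin nte → X)) : ℝ :=
  let d := firstPart hρ s.1
  let b := bhat (fun j => (d j).1, s.2)
  let g := ghat (secondPart ρ s.1)
  (1 / (⌊ρ * ntr⌋₊ : ℝ)) * ∑ j, b j * ((d j).2 - g (d j).1) + (1 / (nte : ℝ)) * ∑ i, g (s.2 i)

end Estimator

section Model

variable {X : Type*} [MeasurableSpace X]

/-- The regression function `g(x) = E[Y | x]` of the conditional law `κ` of `Y` given `x`. -/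
def regressionFun (κ : Kernel X ℝ) (x : X) : ℝ := ∫ y, y ∂(κ x)

/-- The target `ν = E[Y]` under the test distribution with covariate law `μte`. -/
def targetMean (μte : Measure X) (κ : Kernel X ℝ) : ℝ := ∫ p, p.2 ∂(μte ⊗ₘ κ)

/-- The law of the sample: `ntr` labelled training points drawn from `μtr(dx) κ(x, dy)` and `nte`
unlabelled test points drawn from `μte`, all independent. -/
def sampleLaw (μtr μte : Measure X) (κ : Kernel X ℝ) (ntr nte : ℕ) :
    Measure ((Fin ntr → X × ℝ) × (Fin nte → X)) :=
  (Measure.pi fun _ => μtr ⊗ₘ κ).prod (Measure.pi fun _ => μte)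

variable (H : Type*) [NormedAddCommGroup H] [InnerProductSpace ℝ H] [CompleteSpace H]
  [RKHS ℝ H X ℝ]

/-- `|V_R(ρ) - ν| = O(rate ntr nte)` in expectation, with regularization parameter `reg ntr nte`;
the constant is uniform in the sample sizes and in the choice of optimal weights. -/
def RateInExpectation (μtr μte : Measure X) (κ : Kernel X ℝ) (B : ℝ) {ρ : ℝ} (hρ : ρ ≤ 1)
    (reg rate : ℕ → ℕ → ℝ) : Prop :=
  ∃ C : ℝ, ∀ ntr nte : ℕ, 1 ≤ ⌊ρ * ntr⌋₊ → 1 ≤ nte →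
    ∀ bhat : (Fin ⌊ρ * ntr⌋₊ → X) × (Fin nte → X) → Fin ⌊ρ * ntr⌋₊ → ℝ, IsKMMSolver H B bhat →
    ∀ ghat : (Fin (ntr - ⌊ρ * ntr⌋₊) → X × ℝ) → H,
      (∀ d, IsRegularizedLS (reg ntr nte) d (ghat d)) →
    Integrable (fun s => |robustEstimator hρ bhat ghat s - targetMean μte κ|)
        (sampleLaw μtr μte κ ntr nte) ∧
      ∫ s, |robustEstimator hρ bhat ghat s - targetMean μte κ| ∂(sampleLaw μtr μte κ ntr nte)
        ≤ C * rate ntr nte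

/-- `|V_R(ρ) - ν| = O(rate ntr nte)` with high probability: for every `δ` there is a constant,
uniform in the sample sizes and in the choice of optimal weights, for which the bound fails with
probability at most `δ`. -/
def RateInProbability (μtr μte : Measure X) (κ : Kernel X ℝ) (B : ℝ) {ρ : ℝ} (hρ : ρ ≤ 1)
    (reg rate : ℕ → ℕ → ℝ) : Prop :=
  ∀ δ : ℝ, 0 < δ → δ < 1 → ∃ C : ℝ, ∀ ntr nte : ℕ, 1 ≤ ⌊ρ * ntr⌋₊ → 1 ≤ nte →
    ∀ bhat : (Fin ⌊ρ * ntr⌋₊ → X) × (Fin nte → X) → Fin ⌊ρ * ntr⌋₊ → ℝ, IsKMMSolver H B bhat →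
    ∀ ghat : (Fin (ntr - ⌊ρ * ntr⌋₊) → X × ℝ) → H,
      (∀ d, IsRegularizedLS (reg ntr nte) d (ghat d)) →
    sampleLaw μtr μte κ ntr nte
        {s | C * rate ntr nte < |robustEstimator hρ bhat ghat s - targetMean μte κ|}
      ≤ ENNReal.ofReal δ

end Model

end

end CovariateShift

/-! Everything rests on the mean square bound `E (V_R - ν)² ≤ C (γ^(2r) + 1/n_tr + 1/n_te)` for `γ ≥
1/n_tr`, with `r = θ/(2θ+4) < 1/2`. Since `1/n ≤ n^(-2r)`, both choices of `γ` give the stated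
rates; the bound in expectation follows by comparing first and second moments, the bound in
probability by Markov's inequality.

Write `y = g(x) + noise`. Ridge regression is linear in its targets, so the fit is the sum of a
noiseless fit and a fit to the noise, and the error splits into five terms. Two are elementary: the
weighted label noise of the first part of the training data and the fluctuation of the test mean of
`g` have second moments of order `1/k` and `1/n_te`.

The noise fit enters only through its inner product with the kernel mean discrepancy `D`. The true
density is feasible in the matching program, so optimality makes `E ‖D‖²` of order `1/k + 1/n_te`
(`exists_integrable_kmmObjective_bound`). The inner product equals `∑ a_i e_i`, where the
coefficients `a` depend on covariates only, so they are uncorrelated with the noise `e`, and `∑ a_i²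
≤ ‖D‖²/(4 lam)` (`inner_ridgeFit`, `sum_ridgeCoef_sq_le`). Here `lam = mγ ≥ 1 - ρ`, so nothing is
lost.

The remaining two terms are the bias of the noiseless fit at independent points. By exchangeability
of `m + 1` points and a leave-one-out comparison, the error at a fresh point is at most a constant
times the averaged in-sample error, which is bounded by the ridge objective of any competitor `h`
(`integral_ridgeFit_succ_sub_sq_le`). The source condition supplies an `h` with objective
`O(γ^(2r))` by spectral cut-off at level `γ` (`exists_approx_of_mem_fracPowRange`). Passing to the
test law costs a factor `B`. -/

namespace CovariateShift

/-! ### Evaluation and measurability in the reproducing kernel space. -/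

section RKHSFacts

variable {X : Type*} {H : Type*} [NormedAddCommGroup H] [InnerProductSpace ℝ H] [CompleteSpace H]
  [RKHS ℝ H X ℝ]

lemma inner_featureMap (f : H) (x : X) : inner ℝ f (featureMap H x) = f x := by
  simp [featureMap]

lemma featureMap_apply (x x' : X) : featureMap H x x' = kernelFun H x x' := by
  rw [← inner_featureMap, kernelFun]

lemma kernelFun_comm (x x' : X) : kernelFun H x x' = kernelFun H x' x :=
  real_inner_comm _ _

lemma abs_apply_le {R : ℝ} (hR : ∀ x : X, ‖featureMap H x‖ ≤ R) (f : H) (x : X) :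
    |f x| ≤ ‖f‖ * R := by
  rw [← inner_featureMap]
  exact (abs_real_inner_le_norm _ _).trans (mul_le_mul_of_nonneg_left (hR x) (norm_nonneg _))

lemma sum_smul_featureMap_apply {ι : Type*} [Fintype ι] (a : ι → ℝ) (x : ι → X) (x' : X) :
    (∑ i, a i • featureMap H (x i)) x' = ∑ i, a i * kernelFun H (x i) x' := by
  rw [← inner_featureMap, sum_inner]
  simp [inner_smul_left, kernelFun]

lemma sum_mul_sum_smul_featureMap {ι : Type*} [Fintype ι] (x : ι → X) (a : ι → ℝ) (f : H) :
    ∑ i, a i * f (x i) = inner ℝ f (∑ i, a i • featureMap H (x i)) := by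
  simp [inner_sum, inner_smul_right, inner_featureMap]

lemma measurable_kernelFun_comp {Ω : Type*} [MeasurableSpace Ω] [MeasurableSpace X]
    (hK : Measurable (Function.uncurry (kernelFun H : X → X → ℝ))) {u v : Ω → X}
    (hu : Measurable u) (hv : Measurable v) : Measurable fun ω => kernelFun H (u ω) (v ω) := by
  have h : Measurable (Function.uncurry (kernelFun H : X → X → ℝ) ∘ fun ω => (u ω, v ω)) :=
    hK.comp (hu.prodMk hv)
  exact h

/-- Norm convergence implies pointwise convergence, so the measurable elements form a closed
subspace. It contains the kernel sections, whose span is dense. -/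
lemma measurable_coe [MeasurableSpace X]
    (hK : Measurable (Function.uncurry (kernelFun H : X → X → ℝ))) (f : H) :
    Measurable (f : X → ℝ) := by
  let W : Submodule ℝ H :=
    { carrier := {f | Measurable (f : X → ℝ)}
      add_mem' := fun {a b} ha hb => by
        simp only [mem_ofPred_eq, RKHS.coe_add] at *; exact ha.add hb
      zero_mem' := by
        simp only [mem_ofPred_eq, RKHS.coe_zero]; exact measurable_const
      smul_mem' := fun c a ha => by
        simp only [mem_ofPred_eq, RKHS.coe_smul] at *; exact ha.const_smul c }
  have hcl : IsClosed (W : Set H) := by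
    refine isClosed_of_closure_subset fun f hf => ?_
    obtain ⟨u, hu, hlim⟩ := mem_closure_iff_seq_limit.1 hf
    refine measurable_of_tendsto_metrizable hu (tendsto_pi_nhds.2 fun x => ?_)
    exact ((RKHS.continuous_eval x).tendsto f).comp hlim
  have hspan : Submodule.span ℝ {RKHS.kerFun H x v | (x : X) (v : ℝ)} ≤ W := by
    refine Submodule.span_le.2 ?_
    rintro _ ⟨x, v, rfl⟩
    have : RKHS.kerFun H x v = v • featureMap H x := by
      rw [featureMap, ← map_smul, smul_eq_mul, mul_one]
    rw [this]
    refine W.smul_mem v ?_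
    change Measurable (featureMap H x : X → ℝ)
    have h2 : (featureMap H x : X → ℝ) = fun x' => kernelFun H x x' :=
      funext fun x' => featureMap_apply x x'
    rw [h2]
    exact measurable_kernelFun_comp hK measurable_const measurable_id
  have htop := Submodule.topologicalClosure_minimal _ hspan hcl
  rw [RKHS.kerFun_dense] at htop
  have hf : f ∈ W := htop (Submodule.mem_top : f ∈ (⊤ : Submodule ℝ H))
  exact hf

end RKHSFacts

/-! ### Ridge regression through the regularized Gram matrix. -/

section Ridge

variable {X : Type*} {H : Type*} [NormedAddCommGroup H] [InnerProductSpace ℝ H] [CompleteSpace H]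
  [RKHS ℝ H X ℝ] {ι : Type*} [Fintype ι] [DecidableEq ι]

variable (H) in
/-- The regularized Gram matrix `(K(x_i, x_j)) + lam I`. -/
noncomputable def regGram (lam : ℝ) (x : ι → X) : Matrix ι ι ℝ :=
  Matrix.of fun i j => kernelFun H (x i) (x j) + if i = j then lam else 0

variable (H) in
/-- The dual coefficients of the ridge regression fit. -/
noncomputable def ridgeCoef (lam : ℝ) (x : ι → X) (t : ι → ℝ) : ι → ℝ :=
  (regGram H lam x)⁻¹.mulVec t

variable (H) in
/-- The minimizer of `∑ (f(x_i) - t_i)² + lam ‖f‖²`. -/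
noncomputable def ridgeFit (lam : ℝ) (x : ι → X) (t : ι → ℝ) : H :=
  ∑ i, ridgeCoef H lam x t i • featureMap H (x i)

lemma regGram_mulVec (lam : ℝ) (x : ι → X) (a : ι → ℝ) (i : ι) :
    (regGram H lam x).mulVec a i = (∑ j, a j • featureMap H (x j)) (x i) + lam * a i := by
  rw [sum_smul_featureMap_apply]
  simp only [regGram, Matrix.mulVec, dotProduct, Matrix.of_apply, add_mul, Finset.sum_add_distrib,
    ite_mul, zero_mul, Finset.sum_ite_eq, Finset.mem_univ, if_true]
  congr 1
  exact Finset.sum_congr rfl fun j _ => by rw [kernelFun_comm, mul_comm]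

/-- If `a` is in the kernel, pairing the equation with `a` gives `‖f‖² + lam ∑ a_i² = 0` for `f = ∑
a_i Φ(x_i)`. -/
lemma isUnit_det_regGram {lam : ℝ} (hlam : 0 < lam) (x : ι → X) :
    IsUnit (regGram H lam x).det := by
  rw [← Matrix.isUnit_iff_isUnit_det, ← Matrix.mulVec_injective_iff_isUnit]
  rw [← Matrix.coe_mulVecLin, ← LinearMap.ker_eq_bot, LinearMap.ker_eq_bot']
  intro a ha
  have h0 : ∀ i, (∑ j, a j • featureMap H (x j)) (x i) + lam * a i = 0 := fun i => by
    rw [← regGram_mulVec]; exact congrFun ha i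
  set f := ∑ j, a j • featureMap H (x j) with hf
  have h1 : ∑ i, a i * (f (x i) + lam * a i) = 0 :=
    Finset.sum_eq_zero fun i _ => by rw [h0, mul_zero]
  have h2 : ∑ i, a i * (f (x i) + lam * a i) = ‖f‖ ^ 2 + lam * ∑ i, a i ^ 2 := by
    rw [Finset.mul_sum, ← real_inner_self_eq_norm_sq]
    nth_rewrite 3 [hf]
    rw [← sum_mul_sum_smul_featureMap, ← Finset.sum_add_distrib]
    exact Finset.sum_congr rfl fun i _ => by ring
  have h3 : ∑ i, a i ^ 2 = 0 := by
    have := Finset.sum_nonneg fun i (_ : i ∈ Finset.univ) => sq_nonneg (a i)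
    nlinarith [sq_nonneg ‖f‖]
  funext i
  have := (Finset.sum_eq_zero_iff_of_nonneg fun i _ => sq_nonneg (a i)).1 h3 i (Finset.mem_univ i)
  simpa using this

/-- The residual is `lam` times the dual coefficient. This is the only property of the matrix
inverse used in the estimates below. -/
lemma ridgeFit_apply_add {lam : ℝ} (hlam : 0 < lam) (x : ι → X) (t : ι → ℝ) (i : ι) :
    ridgeFit H lam x t (x i) + lam * ridgeCoef H lam x t i = t i := by
  rw [ridgeFit, ← regGram_mulVec, ridgeCoef, Matrix.mulVec_mulVec,
    Matrix.mul_nonsing_inv _ (isUnit_det_regGram hlam x), Matrix.one_mulVec]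

lemma ridgeFit_add (lam : ℝ) (x : ι → X) (t s : ι → ℝ) :
    ridgeFit H lam x (t + s) = ridgeFit H lam x t + ridgeFit H lam x s := by
  simp only [ridgeFit, ridgeCoef, Matrix.mulVec_add, Pi.add_apply, add_smul, Finset.sum_add_distrib]

/-- The normal equations of ridge regression, tested against `f`. -/
lemma ridgeFit_normal_eq {lam : ℝ} (hlam : 0 < lam) (x : ι → X) (t : ι → ℝ) (f : H) :
    ∑ i, (ridgeFit H lam x t (x i) - t i) * f (x i) + lam * inner ℝ f (ridgeFit H lam x t) = 0 := by
  nth_rewrite 2 [ridgeFit]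
  rw [← sum_mul_sum_smul_featureMap, Finset.mul_sum, ← Finset.sum_add_distrib]
  refine Finset.sum_eq_zero fun i _ => ?_
  rw [← ridgeFit_apply_add (H := H) hlam x t i]
  ring

/-- The objective is quadratic and its linear part at the fit vanishes by the normal equations.
Optimality and uniqueness of the fit are both read off from this identity. -/
lemma ridge_objective_eq {lam : ℝ} (hlam : 0 < lam) (x : ι → X) (t : ι → ℝ) (f : H) :
    ∑ i, (f (x i) - t i) ^ 2 + lam * ‖f‖ ^ 2 =
      ∑ i, (ridgeFit H lam x t (x i) - t i) ^ 2 + lam * ‖ridgeFit H lam x t‖ ^ 2 +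
        (∑ i, (f (x i) - ridgeFit H lam x t (x i)) ^ 2 + lam * ‖f - ridgeFit H lam x t‖ ^ 2) := by
  have h := ridgeFit_normal_eq (H := H) hlam x t (f - ridgeFit H lam x t)
  rw [inner_sub_left, real_inner_self_eq_norm_sq] at h
  simp only [RKHS.coe_sub, Pi.sub_apply] at h
  have h2 : ∑ i, (f (x i) - t i) ^ 2 = ∑ i, (ridgeFit H lam x t (x i) - t i) ^ 2 +
      ∑ i, (f (x i) - ridgeFit H lam x t (x i)) ^ 2 +
      2 * ∑ i, (ridgeFit H lam x t (x i) - t i) * (f (x i) - ridgeFit H lam x t (x i)) := by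
    rw [Finset.mul_sum, ← Finset.sum_add_distrib, ← Finset.sum_add_distrib]
    exact Finset.sum_congr rfl fun i _ => by ring
  rw [h2, norm_sub_sq_real]
  linear_combination 2 * h

lemma ridge_objective_le {lam : ℝ} (hlam : 0 < lam) (x : ι → X) (t : ι → ℝ) (f : H) :
    ∑ i, (ridgeFit H lam x t (x i) - t i) ^ 2 + lam * ‖ridgeFit H lam x t‖ ^ 2 ≤
      ∑ i, (f (x i) - t i) ^ 2 + lam * ‖f‖ ^ 2 := by
  rw [ridge_objective_eq hlam x t f]
  have : 0 ≤ ∑ i, (f (x i) - ridgeFit H lam x t (x i)) ^ 2 :=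
    Finset.sum_nonneg fun i _ => sq_nonneg _
  have := mul_nonneg hlam.le (sq_nonneg ‖f - ridgeFit H lam x t‖)
  linarith

lemma eq_ridgeFit_of_objective_le {lam : ℝ} (hlam : 0 < lam) (x : ι → X) (t : ι → ℝ) {f : H}
    (hf : ∑ i, (f (x i) - t i) ^ 2 + lam * ‖f‖ ^ 2 ≤
      ∑ i, (ridgeFit H lam x t (x i) - t i) ^ 2 + lam * ‖ridgeFit H lam x t‖ ^ 2) :
    f = ridgeFit H lam x t := by
  rw [ridge_objective_eq hlam x t f] at hf
  have h1 : 0 ≤ ∑ i, (f (x i) - ridgeFit H lam x t (x i)) ^ 2 :=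
    Finset.sum_nonneg fun i _ => sq_nonneg _
  have h2 : ‖f - ridgeFit H lam x t‖ ^ 2 = 0 := by
    nlinarith [sq_nonneg ‖f - ridgeFit H lam x t‖]
  exact sub_eq_zero.1 (norm_eq_zero.1 (pow_eq_zero_iff two_ne_zero |>.1 h2))

lemma norm_ridgeFit_sq_le {lam : ℝ} (hlam : 0 < lam) (x : ι → X) (t : ι → ℝ) :
    lam * ‖ridgeFit H lam x t‖ ^ 2 ≤ ∑ i, t i ^ 2 := by
  have h := ridge_objective_le (H := H) hlam x t 0
  have h1 : 0 ≤ ∑ i, (ridgeFit H lam x t (x i) - t i) ^ 2 :=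
    Finset.sum_nonneg fun i _ => sq_nonneg _
  simp only [RKHS.coe_zero, Pi.zero_apply, zero_sub, neg_sq, norm_zero] at h
  linarith

/-- The objective is symmetric in the data points and its minimizer is unique. This symmetry is what
makes the in-sample residuals exchangeable. -/
lemma ridgeFit_comp_perm {lam : ℝ} (hlam : 0 < lam) (x : ι → X) (t : ι → ℝ) (σ : Equiv.Perm ι) :
    ridgeFit H lam (x ∘ σ) (t ∘ σ) = ridgeFit H lam x t := by
  refine eq_ridgeFit_of_objective_le hlam x t ?_
  have h := ridge_objective_le (H := H) hlam (x ∘ σ) (t ∘ σ) (ridgeFit H lam x t)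
  simp only [Function.comp_apply] at h
  rwa [Equiv.sum_comp σ (fun i => (ridgeFit H lam x t (x i) - t i) ^ 2),
    Equiv.sum_comp σ (fun i => (ridgeFit H lam (x ∘ σ) (t ∘ σ) (x i) - t i) ^ 2)] at h

/-- The transpose of the ridge fit: `⟪D, ridgeFit x e⟫ = ∑ a_i e_i` with `a` the dual coefficients
of the targets `D(x_i)`. -/
lemma inner_ridgeFit {lam : ℝ} (hlam : 0 < lam) (x : ι → X) (e : ι → ℝ) (D : H) :
    inner ℝ D (ridgeFit H lam x e) = ∑ i, ridgeCoef H lam x (fun j => D (x j)) i * e i := by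
  rw [ridgeFit, ← sum_mul_sum_smul_featureMap]
  set a := ridgeCoef H lam x (fun j => D (x j)) with ha
  have h1 : ∀ i, D (x i) = ridgeFit H lam x (fun j => D (x j)) (x i) + lam * a i := fun i =>
    (ridgeFit_apply_add hlam x (fun j => D (x j)) i).symm
  have h2 : ∀ i, e i = ridgeFit H lam x e (x i) + lam * ridgeCoef H lam x e i := fun i =>
    (ridgeFit_apply_add hlam x e i).symm
  -- Both sides are the inner product of the two ridge fits, with targets `e` and `D(x_i)`.
  have h3 : ∑ i, ridgeCoef H lam x e i * ridgeFit H lam x (fun j => D (x j)) (x i) =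
      ∑ i, a i * ridgeFit H lam x e (x i) := by
    rw [sum_mul_sum_smul_featureMap, sum_mul_sum_smul_featureMap, ← ridgeFit, real_inner_comm]
    rfl
  calc ∑ i, ridgeCoef H lam x e i * D (x i)
      = ∑ i, ridgeCoef H lam x e i * ridgeFit H lam x (fun j => D (x j)) (x i) +
          ∑ i, ridgeCoef H lam x e i * (lam * a i) := by
        rw [← Finset.sum_add_distrib]
        exact Finset.sum_congr rfl fun i _ => by rw [h1 i, mul_add]
    _ = ∑ i, a i * e i := by
        rw [h3, ← Finset.sum_add_distrib]
        refine Finset.sum_congr rfl fun i _ => ?_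
        linear_combination (-a i) * h2 i

/-- With `f` the fit to the values of `D`, one has `lam ∑ a_i² = ⟪D - f, f⟫`, and `⟪D, f⟫ - ‖f‖²`
never exceeds `‖D‖²/4`. The bound does not involve the number of points. -/
lemma sum_ridgeCoef_sq_le {lam : ℝ} (hlam : 0 < lam) (x : ι → X) (D : H) :
    ∑ i, ridgeCoef H lam x (fun j => D (x j)) i ^ 2 ≤ ‖D‖ ^ 2 / (4 * lam) := by
  set a := ridgeCoef H lam x (fun j => D (x j)) with ha
  set f := ridgeFit H lam x (fun j => D (x j)) with hf
  have h1 : lam * ∑ i, a i ^ 2 = inner ℝ (D - f) f := by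
    nth_rewrite 2 [hf]
    rw [ridgeFit, ← sum_mul_sum_smul_featureMap, Finset.mul_sum]
    refine Finset.sum_congr rfl fun i _ => ?_
    have := ridgeFit_apply_add (H := H) hlam x (fun j => D (x j)) i
    simp only [RKHS.coe_sub, Pi.sub_apply]
    rw [← this]
    ring
  have h2 : inner ℝ (D - f) f ≤ ‖D‖ ^ 2 / 4 := by
    rw [inner_sub_left, real_inner_self_eq_norm_sq]
    nlinarith [real_inner_le_norm D f, sq_nonneg (‖D‖ / 2 - ‖f‖)]
  rw [le_div_iff₀ (by positivity)]
  linarith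

end Ridge

/-! ### Leave-one-out stability and measurability of the ridge fit. -/

section RidgeSamples

variable {X : Type*} {H : Type*} [NormedAddCommGroup H] [InnerProductSpace ℝ H] [CompleteSpace H]
  [RKHS ℝ H X ℝ]

/-- The leave-one-out residual is at most a constant times the residual of the full fit. -/
lemma abs_ridgeFit_succ_sub_le {R : ℝ} (hR : ∀ x : X, ‖featureMap H x‖ ≤ R) {lam : ℝ}
    (hlam : 0 < lam) {m : ℕ} (x : Fin (m + 1) → X) (t : Fin (m + 1) → ℝ) :
    |ridgeFit H lam (fun j : Fin m => x j.succ) (fun j => t j.succ) (x 0) - t 0| ≤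
      (1 + R ^ 2 / lam) * |ridgeFit H lam x t (x 0) - t 0| := by
  set f := ridgeFit H lam (fun j : Fin m => x j.succ) (fun j => t j.succ)
  set F := ridgeFit H lam x t
  set d := f - F with hd
  have h1 := ridgeFit_normal_eq (H := H) hlam (fun j : Fin m => x j.succ) (fun j => t j.succ) d
  have h2 := ridgeFit_normal_eq (H := H) hlam x t d
  rw [Fin.sum_univ_succ] at h2
  have h3 : ∑ i : Fin m, d (x i.succ) ^ 2 =
      ∑ i : Fin m, (f (x i.succ) - t i.succ) * d (x i.succ) -
        ∑ i : Fin m, (F (x i.succ) - t i.succ) * d (x i.succ) := by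
    rw [← Finset.sum_sub_distrib]
    refine Finset.sum_congr rfl fun i _ => ?_
    simp only [hd, RKHS.coe_sub, Pi.sub_apply]
    ring
  have h4 : ‖d‖ ^ 2 = inner ℝ d f - inner ℝ d F := by
    rw [← inner_sub_right, real_inner_self_eq_norm_sq]
  -- Difference of the two normal equations tested against `d = f - F`: only the term of the omitted
  -- point survives.
  have h5 : ∑ i : Fin m, d (x i.succ) ^ 2 + lam * ‖d‖ ^ 2 = (F (x 0) - t 0) * d (x 0) := by
    rw [h3, h4]; linarith
  have h6 : 0 ≤ ∑ i : Fin m, d (x i.succ) ^ 2 := Finset.sum_nonneg fun i _ => sq_nonneg _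
  have hR0 : 0 ≤ R := (norm_nonneg _).trans (hR (x 0))
  have hdx := abs_apply_le hR d (x 0)
  have h7 : lam * ‖d‖ ^ 2 ≤ |F (x 0) - t 0| * (‖d‖ * R) := by
    calc lam * ‖d‖ ^ 2 ≤ (F (x 0) - t 0) * d (x 0) := by linarith
      _ ≤ |F (x 0) - t 0| * |d (x 0)| := by rw [← abs_mul]; exact le_abs_self _
      _ ≤ _ := mul_le_mul_of_nonneg_left hdx (abs_nonneg _)
  have h8 : lam * ‖d‖ ≤ |F (x 0) - t 0| * R := by
    rcases (norm_nonneg d).eq_or_lt with h | h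
    · rw [← h, mul_zero]; positivity
    · refine le_of_mul_le_mul_right ?_ h
      linarith
  have h9 : |d (x 0)| ≤ R ^ 2 / lam * |F (x 0) - t 0| := by
    rw [div_mul_eq_mul_div, le_div_iff₀ hlam]
    nlinarith
  have h10 : f (x 0) - t 0 = d (x 0) + (F (x 0) - t 0) := by
    simp only [hd, RKHS.coe_sub, Pi.sub_apply]; ring
  rw [h10]
  refine (abs_add_le _ _).trans ?_
  linarith

/-- Multiplying the averaged objective by `m` turns it into the unnormalized one with parameter `m *
gam`. -/
lemma IsRegularizedLS.eq_ridgeFit {gam : ℝ} (hgam : 0 < gam) {m : ℕ} (hm : 0 < m)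
    {d : Fin m → X × ℝ} {f : H} (hf : IsRegularizedLS gam d f) :
    f = ridgeFit H (m * gam) (fun j => (d j).1) (fun j => (d j).2) := by
  have hm' : (0 : ℝ) < m := Nat.cast_pos.2 hm
  refine eq_ridgeFit_of_objective_le (by positivity) _ _ ?_
  have h := hf (mem_univ (ridgeFit H (m * gam) (fun j => (d j).1) (fun j => (d j).2)))
  simp only [mem_ofPred_eq] at h
  have h2 := mul_le_mul_of_nonneg_left h hm'.le
  have h3 : (m : ℝ) * (1 / m) = 1 := by field_simp
  simpa only [mul_add, ← mul_assoc, h3, one_mul] using h2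

/-- A crude bound that grows with the sample size; it serves only to ensure integrability. -/
lemma abs_ridgeFit_apply_le {R : ℝ} (hR : ∀ x : X, ‖featureMap H x‖ ≤ R) {lam : ℝ} (hlam : 0 < lam)
    {ι : Type*} [Fintype ι] [DecidableEq ι] (x : ι → X) {t : ι → ℝ} (ht : ∀ i, |t i| ≤ 1) (z : X) :
    |ridgeFit H lam x t z| ≤ √(Fintype.card ι / lam) * R := by
  have hR0 : 0 ≤ R := (norm_nonneg _).trans (hR z)
  refine (abs_apply_le hR _ z).trans (mul_le_mul_of_nonneg_right ?_ hR0)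
  refine Real.le_sqrt_of_sq_le ?_
  rw [le_div_iff₀ hlam, mul_comm]
  refine (norm_ridgeFit_sq_le hlam x t).trans ?_
  calc ∑ i, t i ^ 2 ≤ ∑ _i : ι, (1 : ℝ) := Finset.sum_le_sum fun i _ => by
        rw [← sq_abs]; exact pow_le_one₀ (abs_nonneg _) (ht i)
    _ = _ := by simp

variable {Ω : Type*} [MeasurableSpace Ω] [MeasurableSpace X] {ι : Type*} [Fintype ι] [DecidableEq ι]

/-- The inverse is the adjugate divided by the determinant, both polynomial in the entries of the
Gram matrix. -/
lemma measurable_ridgeCoef (hK : Measurable (Function.uncurry (kernelFun H : X → X → ℝ)))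
    (lam : ℝ) {x : Ω → ι → X} (hx : Measurable x) {t : Ω → ι → ℝ} (ht : Measurable t) (i : ι) :
    Measurable fun ω => ridgeCoef H lam (x ω) (t ω) i := by
  have hG : Measurable fun ω => (fun i j => regGram H lam (x ω) i j : ι → ι → ℝ) := by
    refine measurable_pi_lambda _ fun i => measurable_pi_lambda _ fun j => ?_
    simp only [regGram, Matrix.of_apply]
    refine Measurable.add_const ?_ _
    exact measurable_kernelFun_comp hK (measurable_pi_iff.1 hx i) (measurable_pi_iff.1 hx j)
  have hdet : Measurable fun A : ι → ι → ℝ => (Matrix.of A).det :=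
    (Continuous.matrix_det (by exact continuous_id)).measurable
  have hadj : ∀ i j, Measurable fun A : ι → ι → ℝ => (Matrix.of A).adjugate i j := fun i j =>
    ((Continuous.matrix_adjugate (A := fun A : ι → ι → ℝ => Matrix.of A)
      (by exact continuous_id)).matrix_elem i j).measurable
  simp only [ridgeCoef, Matrix.mulVec, dotProduct, Matrix.inv_def, Ring.inverse_eq_inv',
    Matrix.smul_apply, smul_eq_mul]
  refine Finset.measurable_sum _ fun j _ => ?_
  exact ((hdet.comp hG).inv.mul ((hadj i j).comp hG)).mul (measurable_pi_iff.1 ht j)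

lemma measurable_ridgeFit (hK : Measurable (Function.uncurry (kernelFun H : X → X → ℝ)))
    (lam : ℝ) {x : Ω → ι → X} (hx : Measurable x) {t : Ω → ι → ℝ} (ht : Measurable t)
    {z : Ω → X} (hz : Measurable z) :
    Measurable fun ω => ridgeFit H lam (x ω) (t ω) (z ω) := by
  simp only [ridgeFit, sum_smul_featureMap_apply]
  refine Finset.measurable_sum _ fun j _ => (measurable_ridgeCoef hK lam hx ht j).mul ?_
  exact measurable_kernelFun_comp hK (measurable_pi_iff.1 hx j) hz

end RidgeSamples

/-! ### The inclusion into `L²` and kernel mean embeddings. -/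

section Embedding

variable {X : Type*} [MeasurableSpace X] {H : Type*} [NormedAddCommGroup H]
  [InnerProductSpace ℝ H] [CompleteSpace H] [RKHS ℝ H X ℝ]

lemma memLp_coe (hK : Measurable (Function.uncurry (kernelFun H : X → X → ℝ))) {R : ℝ}
    (hR : ∀ x : X, ‖featureMap H x‖ ≤ R) (μ : Measure X) [IsFiniteMeasure μ] (f : H) :
    MemLp (f : X → ℝ) 2 μ :=
  MemLp.of_bound (measurable_coe hK f).aestronglyMeasurable (‖f‖ * R)
    (Filter.Eventually.of_forall fun x => abs_apply_le hR f x)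

/-- The inclusion of the bounded-kernel space `H` into `L²(μ)`. -/
noncomputable def toL2 (hK : Measurable (Function.uncurry (kernelFun H : X → X → ℝ))) {R : ℝ}
    (hR : ∀ x : X, ‖featureMap H x‖ ≤ R) (μ : Measure X) [IsProbabilityMeasure μ] :
    H →L[ℝ] Lp ℝ 2 μ :=
  LinearMap.mkContinuous
    { toFun := fun f => (memLp_coe hK hR μ f).toLp _
      map_add' := fun f g => by
        rw [← MemLp.toLp_add]
        exact MemLp.toLp_congr _ _ (Filter.Eventually.of_forall fun x => by simp)
      map_smul' := fun c f => by
        rw [RingHom.id_apply, ← MemLp.toLp_const_smul]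
        exact MemLp.toLp_congr _ _ (Filter.Eventually.of_forall fun x => by simp) }
    R fun f => by
      have hne : Nonempty X := nonempty_of_isProbabilityMeasure μ
      have hR0 : 0 ≤ R := (norm_nonneg _).trans (hR hne.some)
      have h := Lp.norm_le_of_ae_bound (p := 2) (f := (memLp_coe hK hR μ f).toLp _)
        (C := ‖f‖ * R) (mul_nonneg (norm_nonneg _) hR0) (by
          filter_upwards [(memLp_coe hK hR μ f).coeFn_toLp] with x hx
          rw [hx]
          exact abs_apply_le hR f x)
      simpa [mul_comm, measureUnivNNReal] using h

lemma coeFn_toL2 (hK : Measurable (Function.uncurry (kernelFun H : X → X → ℝ))) {R : ℝ}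
    (hR : ∀ x : X, ‖featureMap H x‖ ≤ R) (μ : Measure X) [IsProbabilityMeasure μ] (f : H) :
    (toL2 hK hR μ f : X → ℝ) =ᵐ[μ] f :=
  (memLp_coe hK hR μ f).coeFn_toLp

lemma adjoint_toL2_apply (hK : Measurable (Function.uncurry (kernelFun H : X → X → ℝ))) {R : ℝ}
    (hR : ∀ x : X, ‖featureMap H x‖ ≤ R) (μ : Measure X) [IsProbabilityMeasure μ]
    (w : Lp ℝ 2 μ) (x' : X) :
    (ContinuousLinearMap.adjoint (toL2 hK hR μ) w) x' = ∫ x, kernelFun H x' x * w x ∂μ := by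
  rw [← inner_featureMap, ContinuousLinearMap.adjoint_inner_left, L2.inner_def]
  refine integral_congr_ae ?_
  filter_upwards [coeFn_toL2 hK hR μ (featureMap H x')] with x hx
  rw [hx, featureMap_apply]
  simp

/-- The factorization `T_K = S S*`, with `S` the inclusion of `H` into `L²`, is what links the
source condition to elements of `H`. -/
lemma toL2_adjoint_toL2 (hK : Measurable (Function.uncurry (kernelFun H : X → X → ℝ))) {R : ℝ}
    (hR : ∀ x : X, ‖featureMap H x‖ ≤ R) (μ : Measure X) [IsProbabilityMeasure μ]
    (w : Lp ℝ 2 μ) :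
    toL2 hK hR μ (ContinuousLinearMap.adjoint (toL2 hK hR μ) w) =
      integralOperator hK (abs_kernelFun_le H hR) μ w := by
  refine MemLp.toLp_congr (memLp_coe hK hR μ _)
    (memLp_kernel_integral hK (abs_kernelFun_le H hR) μ w)
    (Filter.Eventually.of_forall fun x' => ?_)
  exact adjoint_toL2_apply hK hR μ w x'

/-- The kernel mean embedding of a probability measure, in the weak sense. -/
lemma exists_meanEmbedding (hK : Measurable (Function.uncurry (kernelFun H : X → X → ℝ))) {R : ℝ}
    (hR : ∀ x : X, ‖featureMap H x‖ ≤ R) (μ : Measure X) [IsProbabilityMeasure μ] :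
    ∃ u : H, ‖u‖ ≤ R ∧ ∀ f : H, inner ℝ u f = ∫ x, f x ∂μ := by
  have hone : MemLp (fun _ : X => (1 : ℝ)) 2 μ := memLp_const 1
  -- The adjoint of the inclusion applied to the constant `1` represents integration, so no
  -- `H`-valued integral is needed.
  set u := ContinuousLinearMap.adjoint (toL2 hK hR μ) (hone.toLp _)
  have hu : ∀ f : H, inner ℝ u f = ∫ x, f x ∂μ := fun f => by
    rw [ContinuousLinearMap.adjoint_inner_left, L2.inner_def]
    refine integral_congr_ae ?_
    filter_upwards [coeFn_toL2 hK hR μ f, hone.coeFn_toLp] with x hx hx1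
    rw [hx, hx1]
    simp
  refine ⟨u, ?_, hu⟩
  have h : ‖u‖ ^ 2 ≤ ‖u‖ * R := by
    rw [← real_inner_self_eq_norm_sq, hu]
    calc ∫ x, u x ∂μ ≤ ‖∫ x, u x ∂μ‖ := le_abs_self _
      _ ≤ ‖u‖ * R * μ.real univ := norm_integral_le_of_norm_le_const
          (Filter.Eventually.of_forall fun x => abs_apply_le hR u x)
      _ = ‖u‖ * R := by simp
  have hne : Nonempty X := nonempty_of_isProbabilityMeasure μ
  have hR0 : 0 ≤ R := (norm_nonneg _).trans (hR hne.some)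
  rcases (norm_nonneg u).eq_or_lt with h0 | h0
  · rwa [← h0]
  · refine le_of_mul_le_mul_left ?_ h0
    rwa [← sq]

end Embedding

/-! ### Approximation under the source condition. -/

section SourceCondition

lemma inner_sum_smul_orthogonal {E : Type*} [NormedAddCommGroup E] [InnerProductSpace ℝ E]
    {v : ℝ → E} (hv : ∀ i j, i ≠ j → inner ℝ (v i) (v j) = 0) (F : Finset ℝ) (a b : ℝ → ℝ) :
    inner ℝ (∑ i ∈ F, a i • v i) (∑ i ∈ F, b i • v i) = ∑ i ∈ F, a i * b i * ‖v i‖ ^ 2 := by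
  rw [sum_inner]
  refine Finset.sum_congr rfl fun i hi => ?_
  rw [inner_sum, Finset.sum_eq_single_of_mem i hi]
  · rw [inner_smul_left, inner_smul_right, real_inner_self_eq_norm_sq]
    simp [mul_assoc]
  · intro j _ hj
    rw [inner_smul_left, inner_smul_right, hv i j hj.symm]
    simp

/-- Spectral cut-off approximation under a source condition `g = T ^ r u` with `T = S S*`. -/
lemma exists_approx_of_mem_fracPowRange {E H : Type*} [NormedAddCommGroup E]
    [InnerProductSpace ℝ E] [CompleteSpace E] [NormedAddCommGroup H] [InnerProductSpace ℝ H]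
    [CompleteSpace H] (S : H →L[ℝ] E) (T : E →ₗ[ℝ] E)
    (hT : ∀ w, S (ContinuousLinearMap.adjoint S w) = T w) {r : ℝ} (hr : 0 < r) (hr2 : r < 1 / 2)
    {g : E} (hg : g ∈ fracPowRange T r) :
    ∃ C : ℝ, 0 ≤ C ∧ ∀ γ : ℝ, 0 < γ → ∃ h : H, ‖S h - g‖ ^ 2 + γ * ‖h‖ ^ 2 ≤ C * γ ^ (2 * r) := by
  obtain ⟨u, v, hv, hu, hgs⟩ := hg
  have hTv : ∀ lam, T (v lam) = lam • v lam := fun lam => Module.End.mem_eigenspace_iff.1 (hv lam)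
  have hTin : ∀ a b, inner ℝ a (T b) =
      inner ℝ (ContinuousLinearMap.adjoint S a) (ContinuousLinearMap.adjoint S b) := fun a b => by
    rw [← hT, ContinuousLinearMap.adjoint_inner_left]
  have hsym : T.IsSymmetric := fun a b => by
    rw [hTin, real_inner_comm, hTin, real_inner_comm]
  have horth : ∀ i j, i ≠ j → inner ℝ (v i) (v j) = 0 := fun i j hij =>
    hsym.orthogonalFamily_eigenspaces hij ⟨v i, hv i⟩ ⟨v j, hv j⟩
  -- Positivity of `S S*` rules out negative eigenvalues, where `lam ^ r` would have no meaning as a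
  -- power of the operator.
  have hneg : ∀ lam, lam < 0 → v lam = 0 := fun lam hlam => by
    have h1 : inner ℝ (v lam) (T (v lam)) = ‖ContinuousLinearMap.adjoint S (v lam)‖ ^ 2 := by
      rw [hTin, real_inner_self_eq_norm_sq]
    rw [hTv, inner_smul_right, real_inner_self_eq_norm_sq] at h1
    have h2 : ‖v lam‖ ^ 2 = 0 := by
      nlinarith [sq_nonneg ‖v lam‖, sq_nonneg ‖ContinuousLinearMap.adjoint S (v lam)‖]
    exact norm_eq_zero.1 (pow_eq_zero_iff two_ne_zero |>.1 h2)
  -- With `M = (‖u‖ + 1)²`: one `M` from the penalty (`hA`), and `2M + 2` from the approximation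
  -- error (`hB`, `hD`).
  refine ⟨3 * (‖u‖ + 1) ^ 2 + 2, by positivity, fun γ hγ => ?_⟩
  have hγr : 0 < γ ^ r := Real.rpow_pos_of_pos hγ r
  -- One finite set of eigenvalues truncates both series; the tail of `g` is already of the allowed
  -- size `γ ^ r`, so all later sums are finite.
  obtain ⟨F, hF1, hF2⟩ : ∃ F : Finset ℝ, ‖∑ i ∈ F, v i - u‖ < 1 ∧
      ‖∑ i ∈ F, i ^ r • v i - g‖ < γ ^ r := by
    have h1 := (Metric.tendsto_nhds.1 hu) 1 one_pos
    have h2 := (Metric.tendsto_nhds.1 hgs) (γ ^ r) hγr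
    obtain ⟨F, hF⟩ := (h1.and h2).exists
    exact ⟨F, by simpa [dist_eq_norm] using hF⟩
  have hsq : γ ^ (2 * r) = (γ ^ r) ^ 2 := by rw [mul_comm, Real.rpow_mul hγ.le]; norm_cast
  have hM : ∑ i ∈ F, ‖v i‖ ^ 2 ≤ (‖u‖ + 1) ^ 2 := by
    have h1 := inner_sum_smul_orthogonal horth F (fun _ => 1) (fun _ => 1)
    simp only [one_smul, one_mul] at h1
    rw [← h1, real_inner_self_eq_norm_sq]
    refine pow_le_pow_left₀ (norm_nonneg _) ?_ 2
    have := norm_add_le (∑ i ∈ F, v i - u) u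
    rw [sub_add_cancel] at this
    linarith
  -- Spectral cut-off: `T w` keeps exactly the components `i ^ r • v i` with `i ≥ γ`. The
  -- approximant is `h = S* w`, for which `S h = T w` and `‖h‖² = ⟪w, T w⟫`.
  let c : ℝ → ℝ := fun i => if γ ≤ i then i ^ (r - 1) else 0
  set w := ∑ i ∈ F, c i • v i with hw
  have hTw : T w = ∑ i ∈ F, (i * c i) • v i := by
    rw [hw, map_sum]
    exact Finset.sum_congr rfl fun i _ => by rw [map_smul, hTv, smul_smul, mul_comm]
  refine ⟨ContinuousLinearMap.adjoint S w, ?_⟩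
  have hA : γ * ‖ContinuousLinearMap.adjoint S w‖ ^ 2 ≤ (‖u‖ + 1) ^ 2 * γ ^ (2 * r) := by
    rw [← real_inner_self_eq_norm_sq, ← hTin, hTw, hw, inner_sum_smul_orthogonal horth,
      Finset.mul_sum]
    calc ∑ i ∈ F, γ * (c i * (i * c i) * ‖v i‖ ^ 2)
        ≤ ∑ i ∈ F, γ ^ (2 * r) * ‖v i‖ ^ 2 := by
          refine Finset.sum_le_sum fun i _ => ?_
          rw [← mul_assoc]
          refine mul_le_mul_of_nonneg_right ?_ (sq_nonneg _)
          by_cases hi : γ ≤ i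
          · have hi0 : 0 < i := hγ.trans_le hi
            have h1 : c i * (i * c i) = i ^ (2 * r - 1) := by
              simp only [c, if_pos hi]
              nth_rewrite 2 [← Real.rpow_one i]
              rw [← Real.rpow_add hi0, ← Real.rpow_add hi0]
              congr 1; ring
            -- Here `r < 1/2` enters: the exponent is negative, so the penalty is worst at the
            -- cut-off.
            have h2 : i ^ (2 * r - 1) ≤ γ ^ (2 * r - 1) :=
              Real.rpow_le_rpow_of_nonpos hγ hi (by linarith)
            have h3 : γ * γ ^ (2 * r - 1) = γ ^ (2 * r) := by
              nth_rewrite 1 [← Real.rpow_one γ]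
              rw [← Real.rpow_add hγ]
              congr 1; ring
            rw [h1, ← h3]
            exact mul_le_mul_of_nonneg_left h2 hγ.le
          · simp only [c, if_neg hi]
            simp only [mul_zero]
            positivity
      _ ≤ _ := by
          rw [← Finset.mul_sum, mul_comm]
          exact mul_le_mul_of_nonneg_right hM (by positivity)
  have hB : ‖T w - ∑ i ∈ F, i ^ r • v i‖ ^ 2 ≤ (‖u‖ + 1) ^ 2 * γ ^ (2 * r) := by
    have h1 : T w - ∑ i ∈ F, i ^ r • v i = ∑ i ∈ F, (i * c i - i ^ r) • v i := by
      rw [hTw, ← Finset.sum_sub_distrib]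
      exact Finset.sum_congr rfl fun i _ => by rw [sub_smul]
    rw [h1, ← real_inner_self_eq_norm_sq, inner_sum_smul_orthogonal horth]
    calc ∑ i ∈ F, (i * c i - i ^ r) * (i * c i - i ^ r) * ‖v i‖ ^ 2
        ≤ ∑ i ∈ F, γ ^ (2 * r) * ‖v i‖ ^ 2 := by
          refine Finset.sum_le_sum fun i _ => ?_
          rcases lt_or_ge i 0 with hi | hi
          · simp [hneg i hi]
          refine mul_le_mul_of_nonneg_right ?_ (sq_nonneg _)
          by_cases hiγ : γ ≤ i
          · have hi0 : 0 < i := hγ.trans_le hiγ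
            have h2 : i * c i = i ^ r := by
              simp only [c, if_pos hiγ]
              nth_rewrite 1 [← Real.rpow_one i]
              rw [← Real.rpow_add hi0]
              congr 1; ring
            rw [h2, sub_self, mul_zero]
            positivity
          · simp only [c, if_neg hiγ]
            have h2 : i ^ r ≤ γ ^ r := Real.rpow_le_rpow hi (not_le.1 hiγ).le hr.le
            have h3 : 0 ≤ i ^ r := Real.rpow_nonneg hi r
            rw [hsq]
            nlinarith
      _ ≤ _ := by
          rw [← Finset.mul_sum, mul_comm]
          exact mul_le_mul_of_nonneg_right hM (by positivity)
  rw [hT]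
  have hC : ‖T w - g‖ ≤ ‖T w - ∑ i ∈ F, i ^ r • v i‖ + γ ^ r := by
    have := norm_add_le (T w - ∑ i ∈ F, i ^ r • v i) (∑ i ∈ F, i ^ r • v i - g)
    rw [sub_add_sub_cancel] at this
    linarith
  have hD : ‖T w - g‖ ^ 2 ≤ 2 * ‖T w - ∑ i ∈ F, i ^ r • v i‖ ^ 2 + 2 * (γ ^ r) ^ 2 := by
    have := pow_le_pow_left₀ (norm_nonneg _) hC 2
    nlinarith [sq_nonneg (‖T w - ∑ i ∈ F, i ^ r • v i‖ - γ ^ r)]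
  rw [← hsq] at hD
  linarith

/-- Approximation of a regression function satisfying the source condition by elements of `H`. -/
lemma exists_rkhs_approx {X : Type*} [MeasurableSpace X] {H : Type*} [NormedAddCommGroup H]
    [InnerProductSpace ℝ H] [CompleteSpace H] [RKHS ℝ H X ℝ]
    (hK : Measurable (Function.uncurry (kernelFun H : X → X → ℝ))) {R : ℝ}
    (hR : ∀ x : X, ‖featureMap H x‖ ≤ R) (μ : Measure X) [IsProbabilityMeasure μ]
    {r : ℝ} (hr : 0 < r) (hr2 : r < 1 / 2) {G : X → ℝ}
    (hg : ∃ g ∈ fracPowRange (integralOperator hK (abs_kernelFun_le H hR) μ) r,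
      (g : X → ℝ) =ᵐ[μ] G) :
    ∃ C : ℝ, 0 ≤ C ∧ ∀ γ : ℝ, 0 < γ →
      ∃ h : H, ∫ x, (h x - G x) ^ 2 ∂μ + γ * ‖h‖ ^ 2 ≤ C * γ ^ (2 * r) := by
  obtain ⟨g, hg, hgG⟩ := hg
  obtain ⟨C, hC0, hC⟩ := exists_approx_of_mem_fracPowRange (toL2 hK hR μ) _
    (toL2_adjoint_toL2 hK hR μ) hr hr2 hg
  refine ⟨C, hC0, fun γ hγ => ?_⟩
  obtain ⟨h, hh⟩ := hC γ hγ
  refine ⟨h, ?_⟩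
  have h1 : ‖toL2 hK hR μ h - g‖ ^ 2 = ∫ x, (h x - G x) ^ 2 ∂μ := by
    rw [← real_inner_self_eq_norm_sq, L2.inner_def]
    refine integral_congr_ae ?_
    filter_upwards [Lp.coeFn_sub (toL2 hK hR μ h) g, coeFn_toL2 hK hR μ h, hgG] with x h1 h2 h3
    rw [h1, Pi.sub_apply, h2, h3]
    simp [sq]
  rwa [← h1]

end SourceCondition

/-! ### Resampling, reindexing and second moments under product measures. -/

section ProductMeasures

lemma integral_comp_measurePreserving {α β : Type*} [MeasurableSpace α] [MeasurableSpace β]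
    {μ : Measure α} {ν : Measure β} {f : α → β} (hf : MeasurePreserving f μ ν) {g : β → ℝ}
    (hg : Measurable g) : ∫ a, g (f a) ∂μ = ∫ b, g b ∂ν := by
  rw [← hf.map_eq, integral_map hf.measurable.aemeasurable hg.aestronglyMeasurable]

variable {ι α : Type*} [Fintype ι] [DecidableEq ι] [MeasurableSpace α]

/-- Replacing one coordinate by an independent copy preserves the product law. This stands in for
conditioning on the other coordinates. -/
lemma measurePreserving_update (ν : Measure α) [IsProbabilityMeasure ν] (i : ι) :
    MeasurePreserving (fun p : (ι → α) × α => Function.update p.1 i p.2)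
      ((Measure.pi fun _ => ν).prod ν) (Measure.pi fun _ => ν) := by
  have hm : Measurable fun p : (ι → α) × α => Function.update p.1 i p.2 := by
    refine measurable_pi_lambda _ fun j => ?_
    by_cases h : j = i
    · subst h; simpa using measurable_snd
    · simp only [Function.update_of_ne h]
      exact (measurable_pi_apply j).comp measurable_fst
  refine ⟨hm, (Measure.pi_eq fun s hs => ?_).symm⟩
  rw [Measure.map_apply hm (MeasurableSet.univ_pi hs)]
  have h : (fun p : (ι → α) × α => Function.update p.1 i p.2) ⁻¹' (univ.pi s) =
      (univ.pi (Function.update s i univ)) ×ˢ s i := by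
    ext p
    simp only [mem_preimage, mem_univ_pi, mem_prod]
    constructor
    · refine fun hp => ⟨fun j => ?_, by simpa using hp i⟩
      by_cases h : j = i
      · subst h; simp
      · simpa [h] using hp j
    · rintro ⟨h1, h2⟩ j
      by_cases h : j = i
      · subst h; simpa using h2
      · simpa [h] using h1 j
  rw [h, Measure.prod_prod, Measure.pi_pi, ← Finset.mul_prod_erase _ _ (Finset.mem_univ i),
    ← Finset.mul_prod_erase _ (fun j => ν (s j)) (Finset.mem_univ i)]
  simp only [Function.update_self, measure_univ, one_mul]
  rw [mul_comm]
  congr 1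
  exact Finset.prod_congr rfl fun j hj => by rw [Function.update_of_ne (Finset.ne_of_mem_erase hj)]

/-- Integrate over a fresh copy of coordinate `i` before the rest. Integrability is not required, as
the integral of a non-integrable function is `0` by convention. -/
lemma integral_pi_eq_zero (ν : Measure α) [IsProbabilityMeasure ν] (i : ι) {F : (ι → α) → ℝ}
    (hF : ∀ s, ∫ a, F (Function.update s i a) ∂ν = 0) : ∫ s, F s ∂(Measure.pi fun _ => ν) = 0 := by
  by_cases hint : Integrable F (Measure.pi fun _ => ν)
  · have hp := measurePreserving_update (ι := ι) ν i
    have h2 : Integrable (fun p : (ι → α) × α => F (Function.update p.1 i p.2))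
        ((Measure.pi fun _ => ν).prod ν) := hp.integrable_comp_of_integrable hint
    rw [← hp.map_eq, integral_map hp.measurable.aemeasurable
      (by rw [hp.map_eq]; exact hint.aestronglyMeasurable), integral_prod _ h2]
    simp [hF]
  · exact integral_undef hint

lemma integral_pi_prod_eq_zero (ν : Measure α) [IsProbabilityMeasure ν] {Ω : Type*}
    [MeasurableSpace Ω] (P : Measure Ω) [IsProbabilityMeasure P] (i : ι) {F : (ι → α) × Ω → ℝ}
    (hF : ∀ s w, ∫ a, F (Function.update s i a, w) ∂ν = 0) :
    ∫ p, F p ∂((Measure.pi fun _ => ν).prod P) = 0 := by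
  by_cases hint : Integrable F ((Measure.pi fun _ => ν).prod P)
  · rw [integral_prod_symm _ hint]
    simp [integral_pi_eq_zero ν i (F := fun s => F (s, _)) fun s => hF s _]
  · exact integral_undef hint

/-- The preimage of a box is a box whose sides off the range of `e` are the whole space, of mass
`1`. -/
lemma measurePreserving_comp_injective {ι' : Type*} [Fintype ι'] (ν : Measure α)
    [IsProbabilityMeasure ν] {e : ι' → ι} (he : Function.Injective e) :
    MeasurePreserving (fun s : ι → α => fun j => s (e j)) (Measure.pi fun _ => ν)
      (Measure.pi fun _ => ν) := by
  classical
  have hm : Measurable (fun s : ι → α => fun j => s (e j)) :=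
    measurable_pi_lambda _ fun j => measurable_pi_apply _
  refine ⟨hm, (Measure.pi_eq fun s hs => ?_).symm⟩
  rw [Measure.map_apply hm (MeasurableSet.univ_pi hs)]
  have h : (fun s : ι → α => fun j => s (e j)) ⁻¹' (univ.pi s) =
      univ.pi (Function.extend e s fun _ => univ) := by
    ext p
    simp only [mem_preimage, mem_univ_pi]
    constructor
    · intro hp i
      by_cases hi : ∃ j, e j = i
      · obtain ⟨j, rfl⟩ := hi
        rw [he.extend_apply]; exact hp j
      · rw [Function.extend_apply' _ _ _ hi]; exact mem_univ _
    · intro hp j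
      have := hp (e j)
      rwa [he.extend_apply] at this
  rw [h, Measure.pi_pi]
  have h2 : ∏ i ∈ Finset.univ.image e, ν (Function.extend e s (fun _ => univ) i) =
      ∏ j, ν (s j) := by
    rw [Finset.prod_image fun a _ b _ hab => he hab]
    exact Finset.prod_congr rfl fun j _ => by rw [he.extend_apply]
  rw [← h2]
  refine (Finset.prod_subset (Finset.subset_univ _) fun i _ hi => ?_).symm
  rw [Function.extend_apply', measure_univ]
  rintro ⟨j, rfl⟩
  exact hi (Finset.mem_image_of_mem e (Finset.mem_univ j))

/-- The mean square of a sum of bounded i.i.d. weakly centred vectors. -/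
lemma integral_norm_sum_sq_le {E : Type*} [NormedAddCommGroup E] [InnerProductSpace ℝ E]
    (ν : Measure α) [IsProbabilityMeasure ν] {V : α → E} {c : ℝ} (hc : ∀ a, ‖V a‖ ≤ c)
    (hm : Measurable fun p : α × α => (inner ℝ (V p.1) (V p.2) : ℝ))
    (hV : ∀ b, ∫ a, (inner ℝ (V a) (V b) : ℝ) ∂ν = 0) :
    Measurable (fun s : ι → α => ‖∑ i, V (s i)‖ ^ 2) ∧
    ∫ s, ‖∑ i, V (s i)‖ ^ 2 ∂(Measure.pi fun _ : ι => ν) ≤ Fintype.card ι * c ^ 2 := by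
  have hexp : ∀ s : ι → α, ‖∑ i, V (s i)‖ ^ 2 = ∑ i, ∑ j, (inner ℝ (V (s i)) (V (s j)) : ℝ) :=
    fun s => by rw [← real_inner_self_eq_norm_sq, sum_inner]; simp only [inner_sum]
  have hmij : ∀ i j, Measurable fun s : ι → α => (inner ℝ (V (s i)) (V (s j)) : ℝ) := fun i j => by
    have h : Measurable fun s : ι → α => (s i, s j) :=
      (measurable_pi_apply i).prodMk (measurable_pi_apply j)
    exact hm.comp h
  have hbd : ∀ a b, ‖(inner ℝ (V a) (V b) : ℝ)‖ ≤ c * c := fun a b =>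
    (norm_inner_le_norm _ _).trans (mul_le_mul (hc a) (hc b) (norm_nonneg _)
      ((norm_nonneg _).trans (hc a)))
  have hint : ∀ i j, Integrable (fun s : ι → α => (inner ℝ (V (s i)) (V (s j)) : ℝ))
      (Measure.pi fun _ => ν) := fun i j =>
    Integrable.of_bound (hmij i j).aestronglyMeasurable (c * c)
      (Filter.Eventually.of_forall fun s => hbd _ _)
  simp only [hexp]
  refine ⟨Finset.measurable_sum _ fun i _ => Finset.measurable_sum _ fun j _ => hmij i j, ?_⟩
  rw [integral_finsetSum _ fun i _ => integrable_finsetSum _ fun j _ => hint i j]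
  have hi : ∀ i, ∫ s, ∑ j, (inner ℝ (V (s i)) (V (s j)) : ℝ) ∂(Measure.pi fun _ : ι => ν) ≤
      c ^ 2 := fun i => by
    rw [integral_finsetSum _ fun j _ => hint i j, Finset.sum_eq_single i]
    · calc ∫ s, (inner ℝ (V (s i)) (V (s i)) : ℝ) ∂(Measure.pi fun _ : ι => ν)
          ≤ ∫ _, c * c ∂(Measure.pi fun _ : ι => ν) :=
            integral_mono (hint i i) (integrable_const _) fun s => (le_abs_self _).trans (hbd _ _)
        _ = c ^ 2 := by simp [sq]
    -- Off-diagonal terms: resampling coordinate `i` leaves `s j` fixed, and `V` is weakly centred.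
    · intro j _ hj
      refine integral_pi_eq_zero ν i fun s => ?_
      simpa [Function.update_of_ne hj] using hV (s j)
    · exact fun h => absurd (Finset.mem_univ i) h
  calc _ ≤ ∑ _i : ι, c ^ 2 := Finset.sum_le_sum fun i _ => hi i
    _ = _ := by simp

end ProductMeasures

/-! ### Label noise and its linear combinations. -/

section Noise

variable {X : Type*} [MeasurableSpace X]

lemma measurable_regressionFun (κ : Kernel X ℝ) [IsSFiniteKernel κ] :
    Measurable (regressionFun κ) :=
  (StronglyMeasurable.integral_kernel (f := fun y : ℝ => y) (κ := κ)
    measurable_id.stronglyMeasurable).measurable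

lemma integrable_label {κ : Kernel X ℝ} [IsMarkovKernel κ]
    (hκ : ∀ x, ∀ᵐ y ∂(κ x), y ∈ Icc (0 : ℝ) 1) (x : X) : Integrable (fun y : ℝ => y) (κ x) :=
  Integrable.of_bound measurable_id.aestronglyMeasurable 1 (by
    filter_upwards [hκ x] with y hy
    rw [Real.norm_eq_abs, abs_le]
    exact ⟨by linarith [hy.1], hy.2⟩)

lemma regressionFun_mem_Icc {κ : Kernel X ℝ} [IsMarkovKernel κ]
    (hκ : ∀ x, ∀ᵐ y ∂(κ x), y ∈ Icc (0 : ℝ) 1) (x : X) : regressionFun κ x ∈ Icc (0 : ℝ) 1 := by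
  refine ⟨integral_nonneg_of_ae ((hκ x).mono fun y hy => hy.1), ?_⟩
  calc ∫ y, y ∂(κ x) ≤ ∫ _, (1 : ℝ) ∂(κ x) :=
        integral_mono_ae (integrable_label hκ x) (integrable_const _)
          ((hκ x).mono fun y hy => hy.2)
    _ = 1 := by simp

/-- The noise `y - g(x)` of a labelled point. -/
noncomputable def noise (κ : Kernel X ℝ) (p : X × ℝ) : ℝ := p.2 - regressionFun κ p.1

lemma measurable_noise (κ : Kernel X ℝ) [IsSFiniteKernel κ] : Measurable (noise κ) :=
  measurable_snd.sub ((measurable_regressionFun κ).comp measurable_fst)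

lemma ae_label_mem_Icc {κ : Kernel X ℝ} [IsMarkovKernel κ]
    (hκ : ∀ x, ∀ᵐ y ∂(κ x), y ∈ Icc (0 : ℝ) 1) (μ : Measure X) [IsProbabilityMeasure μ] :
    ∀ᵐ p ∂(μ ⊗ₘ κ), p.2 ∈ Icc (0 : ℝ) 1 :=
  Measure.ae_compProd_of_ae_ae (measurableSet_Icc.preimage measurable_snd)
    (Filter.Eventually.of_forall hκ)

lemma ae_abs_noise_le {κ : Kernel X ℝ} [IsMarkovKernel κ]
    (hκ : ∀ x, ∀ᵐ y ∂(κ x), y ∈ Icc (0 : ℝ) 1) (μ : Measure X) [IsProbabilityMeasure μ] :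
    ∀ᵐ p ∂(μ ⊗ₘ κ), |noise κ p| ≤ 1 := by
  filter_upwards [ae_label_mem_Icc hκ μ] with p hp
  have := regressionFun_mem_Icc hκ p.1
  rw [noise, abs_le]
  exact ⟨by linarith [hp.1, this.2], by linarith [hp.2, this.1]⟩

lemma integral_noise_mul_eq_zero {κ : Kernel X ℝ} [IsMarkovKernel κ]
    (hκ : ∀ x, ∀ᵐ y ∂(κ x), y ∈ Icc (0 : ℝ) 1) (μ : Measure X) [IsProbabilityMeasure μ]
    (G : X → ℝ) : ∫ p, noise κ p * G p.1 ∂(μ ⊗ₘ κ) = 0 := by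
  by_cases hint : Integrable (fun p : X × ℝ => noise κ p * G p.1) (μ ⊗ₘ κ)
  · rw [Measure.integral_compProd hint]
    have h : ∀ x, ∫ y, noise κ (x, y) * G x ∂(κ x) = 0 := fun x => by
      rw [integral_mul_const]
      simp only [noise]
      rw [integral_sub (integrable_label hκ x) (integrable_const _)]
      simp [regressionFun]
    simp [h]
  · exact integral_undef hint

/-- The mean square of a linear combination of noise variables with weights depending only on the
covariates and independent data. -/
lemma integral_sum_noise_mul_sq_le {κ : Kernel X ℝ} [IsMarkovKernel κ]
    (hκ : ∀ x, ∀ᵐ y ∂(κ x), y ∈ Icc (0 : ℝ) 1) (μ : Measure X) [IsProbabilityMeasure μ]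
    {Ω : Type*} [MeasurableSpace Ω] (P : Measure Ω) [IsProbabilityMeasure P]
    {ι J : Type*} [Fintype ι] [DecidableEq ι] [Fintype J] {e : J → ι} (he : Function.Injective e)
    {a : J → (ι → X) × Ω → ℝ} (ha : ∀ j, Measurable (a j)) {c : ℝ} (hc : ∀ j p, |a j p| ≤ c) :
    Integrable (fun s => (∑ j, noise κ (s.1 (e j)) * a j (fun i => (s.1 i).1, s.2)) ^ 2)
      ((Measure.pi fun _ : ι => μ ⊗ₘ κ).prod P) ∧
    ∫ s, (∑ j, noise κ (s.1 (e j)) * a j (fun i => (s.1 i).1, s.2)) ^ 2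
        ∂((Measure.pi fun _ : ι => μ ⊗ₘ κ).prod P) ≤
      ∫ s, ∑ j, a j s ^ 2 ∂((Measure.pi fun _ : ι => μ).prod P) := by
  classical
  set Q := (Measure.pi fun _ : ι => μ ⊗ₘ κ).prod P with hQ
  have hcov : MeasurePreserving
      (fun s : (ι → X × ℝ) × Ω => ((fun i => (s.1 i).1, s.2) : (ι → X) × Ω)) Q
      ((Measure.pi fun _ : ι => μ).prod P) := by
    have h1 : MeasurePreserving (fun (s : ι → X × ℝ) i => (s i).1) (Measure.pi fun _ => μ ⊗ₘ κ)
        (Measure.pi fun _ => μ) :=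
      measurePreserving_pi (fun _ : ι => μ ⊗ₘ κ) (fun _ => μ)
        (fun i => ⟨measurable_fst, Measure.fst_compProd μ κ⟩)
    exact h1.prod (MeasurePreserving.id P)
  have hnm : ∀ i, Measurable fun s : (ι → X × ℝ) × Ω => noise κ (s.1 i) := fun i =>
    (measurable_noise κ).comp ((measurable_pi_apply i).comp measurable_fst)
  have hn : ∀ i, ∀ᵐ s ∂Q, |noise κ (s.1 i)| ≤ 1 := fun i => by
    have h1 : MeasurePreserving (fun s : (ι → X × ℝ) × Ω => s.1 i) Q (μ ⊗ₘ κ) :=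
      (measurePreserving_eval (fun _ : ι => μ ⊗ₘ κ) i).comp
        (measurePreserving_fst (μ := Measure.pi fun _ : ι => μ ⊗ₘ κ) (ν := P))
    exact h1.quasiMeasurePreserving.ae (ae_abs_noise_le hκ μ)
  let t : J → (ι → X × ℝ) × Ω → ℝ := fun j s =>
    noise κ (s.1 (e j)) * a j (fun i => (s.1 i).1, s.2)
  have htm : ∀ j, Measurable (t j) := fun j => (hnm _).mul ((ha j).comp hcov.measurable)
  have htb : ∀ j, ∀ᵐ s ∂Q, |t j s| ≤ |a j (fun i => (s.1 i).1, s.2)| := fun j => by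
    filter_upwards [hn (e j)] with s hs
    simp only [t, abs_mul]
    exact mul_le_of_le_one_left (abs_nonneg _) hs
  have hint : ∀ j l, Integrable (fun s => t j s * t l s) Q := fun j l => by
    refine Integrable.of_bound ((htm j).mul (htm l)).aestronglyMeasurable (c * c) ?_
    filter_upwards [htb j, htb l] with s h1 h2
    rw [Real.norm_eq_abs, abs_mul]
    exact mul_le_mul (h1.trans (hc _ _)) (h2.trans (hc _ _)) (abs_nonneg _)
      ((abs_nonneg _).trans (hc j (fun i => (s.1 i).1, s.2)))
  have hexp : ∀ s, (∑ j, t j s) ^ 2 = ∑ j, ∑ l, t j s * t l s := fun s => by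
    rw [sq, Finset.sum_mul_sum]
  change Integrable (fun s => (∑ j, t j s) ^ 2) Q ∧ ∫ s, (∑ j, t j s) ^ 2 ∂Q ≤ _
  simp only [hexp]
  refine ⟨integrable_finsetSum _ fun j _ => integrable_finsetSum _ fun l _ => hint j l, ?_⟩
  rw [integral_finsetSum _ fun j _ => integrable_finsetSum _ fun l _ => hint j l]
  have haint : ∀ j, Integrable (fun s => a j s ^ 2) ((Measure.pi fun _ : ι => μ).prod P) :=
    fun j => Integrable.of_bound ((ha j).pow_const 2).aestronglyMeasurable (c ^ 2)
      (Filter.Eventually.of_forall fun s => by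
        rw [Real.norm_eq_abs, abs_pow]
        exact pow_le_pow_left₀ (abs_nonneg _) (hc j s) 2)
  rw [integral_finsetSum _ fun j _ => haint j]
  refine Finset.sum_le_sum fun j _ => ?_
  rw [integral_finsetSum _ fun l _ => hint j l, Finset.sum_eq_single j]
  · rw [← integral_comp_measurePreserving hcov ((ha j).pow_const 2)]
    refine integral_mono_ae (hint j j) (hcov.integrable_comp_of_integrable (haint j)) ?_
    filter_upwards [htb j] with s hs
    have := pow_le_pow_left₀ (abs_nonneg _) hs 2
    simpa [sq_abs, sq] using this
  · intro l _ hl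
    -- Resampling the labelled point `e j` changes the weights only through its covariate; given
    -- that covariate, its noise has mean zero and all other factors are constant.
    refine integral_pi_prod_eq_zero (μ ⊗ₘ κ) P (e j) fun s w => ?_
    have hne : e l ≠ e j := fun h => hl (he h)
    have hup : ∀ p : X × ℝ, (fun i => (Function.update s (e j) p i).1) =
        Function.update (fun i => (s i).1) (e j) p.1 := fun p => by
      funext i
      by_cases h : i = e j
      · subst h; simp
      · simp [Function.update_of_ne h]
    have := integral_noise_mul_eq_zero hκ μ fun x =>
      a j (Function.update (fun i => (s i).1) (e j) x, w) * (noise κ (s (e l)) *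
        a l (Function.update (fun i => (s i).1) (e j) x, w))
    rw [← this]
    refine integral_congr_ae (Filter.Eventually.of_forall fun p => ?_)
    simp only [t, hup, Function.update_self, Function.update_of_ne hne]
    ring
  · exact fun h => absurd (Finset.mem_univ j) h

end Noise

/-! ### Prediction error of the noiseless ridge fit. -/

section Bias

variable {X : Type*} [MeasurableSpace X] {H : Type*} [NormedAddCommGroup H]
  [InnerProductSpace ℝ H] [CompleteSpace H] [RKHS ℝ H X ℝ]

/-- The mean squared prediction error at a fresh point of a ridge fit with noiseless targets. -/
lemma integral_ridgeFit_succ_sub_sq_le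
    (hK : Measurable (Function.uncurry (kernelFun H : X → X → ℝ))) {R : ℝ}
    (hR : ∀ x : X, ‖featureMap H x‖ ≤ R) (μ : Measure X) [IsProbabilityMeasure μ] {G : X → ℝ}
    (hG : Measurable G) (hG1 : ∀ x, |G x| ≤ 1) {lam : ℝ} (hlam : 0 < lam) (m : ℕ) (h : H) :
    ∫ x, (ridgeFit H lam (fun j : Fin m => x j.succ) (fun j => G (x j.succ)) (x 0) - G (x 0)) ^ 2
        ∂(Measure.pi fun _ : Fin (m + 1) => μ) ≤
      (1 + R ^ 2 / lam) ^ 2 * (∫ x, (h x - G x) ^ 2 ∂μ + lam / (m + 1) * ‖h‖ ^ 2) := by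
  set P := Measure.pi fun _ : Fin (m + 1) => μ
  have hGm : ∀ i : Fin (m + 1), Measurable fun x : Fin (m + 1) → X => G (x i) := fun i =>
    hG.comp (measurable_pi_apply i)
  let q : Fin (m + 1) → (Fin (m + 1) → X) → ℝ := fun i x =>
    (ridgeFit H lam x (fun j => G (x j)) (x i) - G (x i)) ^ 2
  have hqm : ∀ i, Measurable (q i) := fun i =>
    ((measurable_ridgeFit hK lam measurable_id (measurable_pi_lambda _ hGm)
      (measurable_pi_apply i)).sub (hGm i)).pow_const 2
  set c := √(Fintype.card (Fin (m + 1)) / lam) * R + 1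
  have hqb : ∀ i x, |q i x| ≤ c ^ 2 := fun i x => by
    simp only [q]
    rw [abs_pow]
    refine pow_le_pow_left₀ (abs_nonneg _) ((abs_sub _ _).trans (add_le_add ?_ (hG1 _))) 2
    exact abs_ridgeFit_apply_le hR hlam x (fun _ => hG1 _) _
  have hqi : ∀ i, Integrable (q i) P := fun i =>
    Integrable.of_bound (hqm i).aestronglyMeasurable (c ^ 2)
      (Filter.Eventually.of_forall fun x => hqb i x)
  -- Swapping points `0` and `i` preserves the product law and does not change the fit.
  have hexch : ∀ i, ∫ x, q i x ∂P = ∫ x, q 0 x ∂P := fun i => by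
    have hp := measurePreserving_comp_injective (ι := Fin (m + 1)) μ (Equiv.swap 0 i).injective
    rw [← integral_comp_measurePreserving hp (hqm 0)]
    refine integral_congr_ae (Filter.Eventually.of_forall fun x => ?_)
    have := ridgeFit_comp_perm (H := H) hlam x (fun j => G (x j)) (Equiv.swap 0 i)
    simp only [q]
    simp only [Function.comp_def] at this
    rw [this, Equiv.swap_apply_left]
  have hhm : ∀ i : Fin (m + 1), MeasurePreserving (fun x : Fin (m + 1) → X => x i) P μ := fun i =>
    measurePreserving_eval (fun _ => μ) i
  have hhi : Integrable (fun x => (h x - G x) ^ 2) μ := by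
    refine Integrable.of_bound (((measurable_coe hK h).sub hG).pow_const 2).aestronglyMeasurable
      ((‖h‖ * R + 1) ^ 2) (Filter.Eventually.of_forall fun x => ?_)
    rw [Real.norm_eq_abs, abs_pow]
    exact pow_le_pow_left₀ (abs_nonneg _)
      ((abs_sub _ _).trans (add_le_add (abs_apply_le hR h x) (hG1 _))) 2
  have hhint : ∀ i : Fin (m + 1), Integrable (fun x : Fin (m + 1) → X => (h (x i) - G (x i)) ^ 2) P :=
    fun i => (hhm i).integrable_comp_of_integrable hhi
  have hheq : ∀ i : Fin (m + 1), ∫ x, (h (x i) - G (x i)) ^ 2 ∂P = ∫ x, (h x - G x) ^ 2 ∂μ :=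
    fun i => integral_comp_measurePreserving (hhm i) (((measurable_coe hK h).sub hG).pow_const 2)
  have hsum : (m + 1 : ℝ) * ∫ x, q 0 x ∂P ≤
      (m + 1) * ∫ x, (h x - G x) ^ 2 ∂μ + lam * ‖h‖ ^ 2 := by
    calc (m + 1 : ℝ) * ∫ x, q 0 x ∂P = ∑ i, ∫ x, q i x ∂P := by simp [hexch]
      _ = ∫ x, ∑ i, q i x ∂P := (integral_finsetSum _ fun i _ => hqi i).symm
      _ ≤ ∫ x, (∑ i, (h (x i) - G (x i)) ^ 2 + lam * ‖h‖ ^ 2) ∂P := by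
          refine integral_mono (integrable_finsetSum _ fun i _ => hqi i)
            ((integrable_finsetSum _ fun i _ => hhint i).add (integrable_const _)) fun x => ?_
          have := ridge_objective_le (H := H) hlam x (fun j => G (x j)) h
          have h0 := mul_nonneg hlam.le (sq_nonneg ‖ridgeFit H lam x (fun j => G (x j))‖)
          simp only [q]
          linarith
      _ = _ := by
          rw [integral_add (integrable_finsetSum _ fun i _ => hhint i) (integrable_const _),
            integral_finsetSum _ fun i _ => hhint i]
          simp [hheq]
  have hm0 : (0 : ℝ) < m + 1 := by positivity
  have hq0 : ∫ x, q 0 x ∂P ≤ ∫ x, (h x - G x) ^ 2 ∂μ + lam / (m + 1) * ‖h‖ ^ 2 := by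
    refine le_of_mul_le_mul_left (hsum.trans (le_of_eq ?_)) hm0
    field_simp
  refine le_trans ?_ (mul_le_mul_of_nonneg_left hq0 (sq_nonneg _))
  rw [← integral_const_mul]
  refine integral_mono_of_nonneg (Filter.Eventually.of_forall fun x => sq_nonneg _)
    ((hqi 0).const_mul _) (Filter.Eventually.of_forall fun x => ?_)
  -- The fit on points `1, …, m` is the leave-one-out fit at point `0`, so its error there is
  -- controlled by the in-sample residual `q 0`.
  have := pow_le_pow_left₀ (abs_nonneg _)
    (abs_ridgeFit_succ_sub_le hR hlam x (fun j => G (x j))) 2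
  rwa [sq_abs, mul_pow, sq_abs] at this

end Bias

/-! ### Importance weights and the matching objective. -/

section KernelMeanMatching

variable {X : Type*} [MeasurableSpace X]

/-- A bounded measurable version of the density of the test law. -/
lemma exists_bounded_density {μtr μte : Measure X} [IsProbabilityMeasure μtr]
    [IsProbabilityMeasure μte] (hac : μte ≪ μtr) {B : ℝ} (hB0 : 0 ≤ B)
    (hB : ∀ᵐ x ∂μtr, μte.rnDeriv μtr x ≤ ENNReal.ofReal B) :
    ∃ b : X → ℝ, Measurable b ∧ (∀ x, b x ∈ Icc 0 B) ∧
      ∀ f : X → ℝ, ∫ x, f x ∂μte = ∫ x, b x * f x ∂μtr := by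
  -- Truncation at `B` changes the density only on a `μtr`-null set and makes the box constraint
  -- hold at every point, hence for every sample.
  refine ⟨fun x => min (μte.rnDeriv μtr x).toReal B,
    (Measure.measurable_rnDeriv _ _).ennreal_toReal.min measurable_const,
    fun x => ⟨le_min ENNReal.toReal_nonneg hB0, min_le_right _ _⟩, fun f => ?_⟩
  rw [← integral_rnDeriv_smul hac]
  refine integral_congr_ae ?_
  filter_upwards [hB] with x hx
  rw [smul_eq_mul, min_eq_left (ENNReal.toReal_le_of_le_ofReal hB0 hx)]

lemma integral_le_mul_integral_of_density {μtr μte : Measure X} {B : ℝ} {b : X → ℝ}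
    (hb : ∀ x, b x ∈ Icc 0 B)
    (hd : ∀ f : X → ℝ, ∫ x, f x ∂μte = ∫ x, b x * f x ∂μtr) {f : X → ℝ} (hf : ∀ x, 0 ≤ f x)
    (hfi : Integrable f μtr) : ∫ x, f x ∂μte ≤ B * ∫ x, f x ∂μtr := by
  rw [hd, ← integral_const_mul]
  exact integral_mono_of_nonneg (Filter.Eventually.of_forall fun x => mul_nonneg (hb x).1 (hf x))
    (hfi.const_mul B)
    (Filter.Eventually.of_forall fun x => mul_le_mul_of_nonneg_right (hb x).2 (hf x))

variable {H : Type*} [NormedAddCommGroup H] [InnerProductSpace ℝ H] [CompleteSpace H]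
  [RKHS ℝ H X ℝ]

/-- The squared distance of an importance weighted empirical kernel mean from its expectation. -/
lemma integral_norm_weighted_mean_sub_sq_le
    (hK : Measurable (Function.uncurry (kernelFun H : X → X → ℝ))) {R : ℝ}
    (hR : ∀ x : X, ‖featureMap H x‖ ≤ R) (μ : Measure X) [IsProbabilityMeasure μ] {B : ℝ}
    {b : X → ℝ} (hbm : Measurable b) (hb : ∀ x, b x ∈ Icc 0 B) {u : H} (hu : ‖u‖ ≤ R)
    (hub : ∀ f : H, inner ℝ u f = ∫ x, b x * f x ∂μ) {k : ℕ} (hk : 0 < k) :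
    Measurable (fun x : Fin k → X =>
      ‖(1 / (k : ℝ)) • ∑ j, b (x j) • featureMap H (x j) - u‖ ^ 2) ∧
    ∫ x, ‖(1 / (k : ℝ)) • ∑ j, b (x j) • featureMap H (x j) - u‖ ^ 2
      ∂(Measure.pi fun _ : Fin k => μ) ≤ ((B + 1) * R) ^ 2 / k := by
  have hk' : (0 : ℝ) < k := Nat.cast_pos.2 hk
  let V : X → H := fun x => b x • featureMap H x - u
  have hVf : ∀ (x : X) (f : H), (inner ℝ (V x) f : ℝ) = b x * f x - inner ℝ u f := fun x f => by
    rw [inner_sub_left, inner_smul_left, real_inner_comm, inner_featureMap]; rfl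
  have hVx : ∀ (x z : X), V x z = b x * kernelFun H x z - u z := fun x z => by
    simp only [V, RKHS.coe_sub, RKHS.coe_smul, Pi.sub_apply, Pi.smul_apply, smul_eq_mul,
      featureMap_apply]
  have huV : ∀ z : X, (inner ℝ u (V z) : ℝ) = b z * u z - inner ℝ u u := fun z => by
    rw [real_inner_comm, hVf]
  have hc : ∀ x, ‖V x‖ ≤ (B + 1) * R := fun x => by
    have h1 : ‖b x • featureMap H x‖ ≤ B * R := by
      rw [norm_smul, Real.norm_eq_abs, abs_of_nonneg (hb x).1]
      exact mul_le_mul (hb x).2 (hR x) (norm_nonneg _) ((hb x).1.trans (hb x).2)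
    calc ‖V x‖ ≤ ‖b x • featureMap H x‖ + ‖u‖ := norm_sub_le _ _
      _ ≤ (B + 1) * R := by linarith
  have hum : Measurable (u : X → ℝ) := measurable_coe hK u
  -- The inner product is expanded into scalar functions, so no measurability of `V` as a map into
  -- `H` is needed.
  have hm : Measurable fun p : X × X => (inner ℝ (V p.1) (V p.2) : ℝ) := by
    have h : ∀ p : X × X, (inner ℝ (V p.1) (V p.2) : ℝ) =
        b p.1 * (b p.2 * kernelFun H p.2 p.1 - u p.1) - (b p.2 * u p.2 - inner ℝ u u) :=
      fun p => by rw [hVf, hVx, huV]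
    simp only [h]
    have hkm : Measurable fun p : X × X => kernelFun H p.2 p.1 :=
      measurable_kernelFun_comp hK measurable_snd measurable_fst
    have hb1 : Measurable fun p : X × X => b p.1 := hbm.comp measurable_fst
    have hb2 : Measurable fun p : X × X => b p.2 := hbm.comp measurable_snd
    have hu1 : Measurable fun p : X × X => u p.1 := hum.comp measurable_fst
    have hu2 : Measurable fun p : X × X => u p.2 := hum.comp measurable_snd
    exact (hb1.mul ((hb2.mul hkm).sub hu1)).sub ((hb2.mul hu2).sub_const _)
  have hV0 : ∀ z, ∫ x, (inner ℝ (V x) (V z) : ℝ) ∂μ = 0 := fun z => by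
    simp only [hVf]
    rw [integral_sub, hub]
    · simp
    · refine Integrable.of_bound (hbm.mul (measurable_coe hK (V z))).aestronglyMeasurable
        (B * (‖V z‖ * R)) (Filter.Eventually.of_forall fun x => ?_)
      rw [norm_mul, Real.norm_eq_abs, Real.norm_eq_abs, abs_of_nonneg (hb x).1]
      exact mul_le_mul (hb x).2 (abs_apply_le hR _ x) (abs_nonneg _) ((hb x).1.trans (hb x).2)
    · exact integrable_const _
  have hmain := integral_norm_sum_sq_le (ι := Fin k) μ hc hm hV0
  have heq : ∀ x : Fin k → X, ‖(1 / (k : ℝ)) • ∑ j, b (x j) • featureMap H (x j) - u‖ ^ 2 =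
      (1 / (k : ℝ)) ^ 2 * ‖∑ j, V (x j)‖ ^ 2 := fun x => by
    have h1 : (1 / (k : ℝ)) • ∑ j, b (x j) • featureMap H (x j) - u =
        (1 / (k : ℝ)) • ∑ j, V (x j) := by
      simp only [V, Finset.sum_sub_distrib, smul_sub, Finset.sum_const, Finset.card_univ,
        Fintype.card_fin]
      rw [← Nat.cast_smul_eq_nsmul ℝ, smul_smul, one_div_mul_cancel hk'.ne', one_smul]
    rw [h1, norm_smul, mul_pow, Real.norm_eq_abs, sq_abs]
  simp only [heq]
  refine ⟨hmain.1.const_mul _, ?_⟩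
  rw [integral_const_mul]
  refine (mul_le_mul_of_nonneg_left hmain.2 (sq_nonneg _)).trans (le_of_eq ?_)
  rw [Fintype.card_fin]
  field_simp


/-- With the true importance weights the kernel mean matching objective is small on average. -/
lemma exists_integrable_kmmObjective_bound
    (hK : Measurable (Function.uncurry (kernelFun H : X → X → ℝ))) {R : ℝ}
    (hR : ∀ x : X, ‖featureMap H x‖ ≤ R) {μtr μte : Measure X} [IsProbabilityMeasure μtr]
    [IsProbabilityMeasure μte] {B : ℝ} {b : X → ℝ} (hbm : Measurable b)
    (hb : ∀ x, b x ∈ Icc 0 B) (hd : ∀ f : X → ℝ, ∫ x, f x ∂μte = ∫ x, b x * f x ∂μtr)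
    {k l : ℕ} (hk : 0 < k) (hl : 0 < l) :
    ∃ q : (Fin k → X) × (Fin l → X) → ℝ, Measurable q ∧
      Integrable q ((Measure.pi fun _ => μtr).prod (Measure.pi fun _ => μte)) ∧
      (∀ p, kmmObjective H p.1 p.2 (fun j => b (p.1 j)) ≤ q p) ∧
      ∫ p, q p ∂((Measure.pi fun _ => μtr).prod (Measure.pi fun _ => μte)) ≤
        2 * (((B + 1) * R) ^ 2 / k) + 2 * ((2 * R) ^ 2 / l) := by
  obtain ⟨u, hu, hue⟩ := exists_meanEmbedding hK hR μte
  obtain ⟨hm1, h1⟩ := integral_norm_weighted_mean_sub_sq_le hK hR μtr hbm hb hu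
    (fun f => by rw [hue, hd]) hk
  -- The test sample is the case of constant weight `1`; both empirical means are centred at the
  -- same embedding `u` of the test law.
  obtain ⟨hm2, h2⟩ := integral_norm_weighted_mean_sub_sq_le hK hR μte (b := fun _ => 1)
    (B := 1) measurable_const (fun _ => ⟨zero_le_one, le_rfl⟩) hu
    (fun f => by rw [hue]; simp) hl
  have hbd : ∀ {n : ℕ} (w : X → ℝ) (C : ℝ), (∀ x, w x ∈ Icc 0 C) → ∀ x : Fin n → X,
      ‖‖(1 / (n : ℝ)) • ∑ j, w (x j) • featureMap H (x j) - u‖ ^ 2‖ ≤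
        (1 / (n : ℝ) * (n * (C * R)) + R) ^ 2 := fun {n} w C hw x => by
    rw [norm_pow, norm_norm]
    refine pow_le_pow_left₀ (norm_nonneg _) ((norm_sub_le _ _).trans (add_le_add ?_ hu)) 2
    rw [norm_smul, Real.norm_eq_abs, abs_of_nonneg (by positivity)]
    refine mul_le_mul_of_nonneg_left ((norm_sum_le _ _).trans ?_) (by positivity)
    calc ∑ j, ‖w (x j) • featureMap H (x j)‖ ≤ ∑ _j : Fin n, C * R :=
          Finset.sum_le_sum fun j _ => by
            rw [norm_smul, Real.norm_eq_abs, abs_of_nonneg (hw _).1]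
            exact mul_le_mul (hw _).2 (hR _) (norm_nonneg _) ((hw (x j)).1.trans (hw (x j)).2)
      _ = _ := by simp
  have hi1 := Integrable.of_bound (μ := Measure.pi fun _ : Fin k => μtr) hm1.aestronglyMeasurable _
    (Filter.Eventually.of_forall (hbd b B hb))
  have hi2 := Integrable.of_bound (μ := Measure.pi fun _ : Fin l => μte) hm2.aestronglyMeasurable _
    (Filter.Eventually.of_forall (hbd (fun _ => 1) 1 fun _ => ⟨zero_le_one, le_rfl⟩))
  have hj1 := (hi1.comp_fst (Measure.pi fun _ : Fin l => μte)).const_mul 2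
  have hj2 := (hi2.comp_snd (Measure.pi fun _ : Fin k => μtr)).const_mul 2
  refine ⟨_, ((hm1.comp measurable_fst).const_mul 2).add ((hm2.comp measurable_snd).const_mul 2),
    hj1.add hj2, fun p => ?_, ?_⟩
  · simp only [Pi.add_apply, Function.comp_apply, one_smul, kmmObjective]
    set a := (1 / (k : ℝ)) • ∑ j, b (p.1 j) • featureMap H (p.1 j)
    set c := (1 / (l : ℝ)) • ∑ i, featureMap H (p.2 i)
    have h3 : ‖a - c‖ ≤ ‖a - u‖ + ‖c - u‖ := by
      rw [← sub_sub_sub_cancel_right a c u]; exact norm_sub_le _ _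
    have h4 := pow_le_pow_left₀ (norm_nonneg _) h3 2
    nlinarith [sq_nonneg (‖a - u‖ - ‖c - u‖)]
  · simp only [Pi.add_apply, Function.comp_apply]
    rw [integral_add hj1 hj2, integral_const_mul, integral_const_mul]
    rw [integral_comp_measurePreserving measurePreserving_fst hm1,
      integral_comp_measurePreserving measurePreserving_snd hm2]
    have : (1 + 1 : ℝ) = 2 := by norm_num
    rw [this] at h2
    linarith

end KernelMeanMatching

lemma sq_mean_le_mean_sq {k : ℕ} (hk : 0 < k) (f : Fin k → ℝ) :
    ((1 / (k : ℝ)) * ∑ j, f j) ^ 2 ≤ (1 / (k : ℝ)) * ∑ j, f j ^ 2 := by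
  have hk' : (0 : ℝ) < k := Nat.cast_pos.2 hk
  have h := sq_sum_le_card_mul_sum_sq (s := Finset.univ) (f := f)
  rw [Finset.card_univ, Fintype.card_fin] at h
  rw [mul_pow]
  calc (1 / (k : ℝ)) ^ 2 * (∑ j, f j) ^ 2 ≤ (1 / (k : ℝ)) ^ 2 * (k * ∑ j, f j ^ 2) :=
        mul_le_mul_of_nonneg_left h (sq_nonneg _)
    _ = _ := by field_simp

lemma mean_le_of_le {k : ℕ} (hk : 0 < k) {f : Fin k → ℝ} {c : ℝ} (hf : ∀ j, f j ≤ c) :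
    (1 / (k : ℝ)) * ∑ j, f j ≤ c := by
  have hk' : (0 : ℝ) < k := Nat.cast_pos.2 hk
  rw [one_div, inv_mul_le_iff₀ hk']
  calc ∑ j, f j ≤ ∑ _j : Fin k, c := Finset.sum_le_sum fun j _ => hf j
    _ = k * c := by simp

/-! ### The mean discrepancy and the fit error. -/

section ErrorQuantities

variable {X : Type*} {H : Type*} [NormedAddCommGroup H]
  [InnerProductSpace ℝ H] [CompleteSpace H] [RKHS ℝ H X ℝ]

/-- The empirical kernel mean discrepancy for weights chosen by `bhat`. -/
noncomputable def meanDiscrepancy (H : Type*) [NormedAddCommGroup H]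
    [InnerProductSpace ℝ H] [CompleteSpace H] [RKHS ℝ H X ℝ] {k l : ℕ}
    (bhat : (Fin k → X) × (Fin l → X) → Fin k → ℝ) (p : (Fin k → X) × (Fin l → X)) : H :=
  (1 / (k : ℝ)) • ∑ j, bhat p j • featureMap H (p.1 j) -
    (1 / (l : ℝ)) • ∑ i, featureMap H (p.2 i)

/-- A regression function in `H` enters the estimator only as minus this inner product; hence the
doubly robust effect, where the error of the fit multiplies that of the weights. -/
lemma inner_meanDiscrepancy {k l : ℕ} (bhat : (Fin k → X) × (Fin l → X) → Fin k → ℝ)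
    (p : (Fin k → X) × (Fin l → X)) (f : H) :
    (inner ℝ (meanDiscrepancy H bhat p) f : ℝ) =
      (1 / (k : ℝ)) * ∑ j, bhat p j * f (p.1 j) - (1 / (l : ℝ)) * ∑ i, f (p.2 i) := by
  rw [meanDiscrepancy, inner_sub_left, inner_smul_left, inner_smul_left, sum_inner, sum_inner]
  simp only [inner_smul_left, real_inner_comm, inner_featureMap]
  rfl

lemma meanDiscrepancy_apply {k l : ℕ} (bhat : (Fin k → X) × (Fin l → X) → Fin k → ℝ)
    (p : (Fin k → X) × (Fin l → X)) (x : X) :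
    meanDiscrepancy H bhat p x = (1 / (k : ℝ)) * ∑ j, bhat p j * kernelFun H x (p.1 j) -
      (1 / (l : ℝ)) * ∑ i, kernelFun H x (p.2 i) := by
  rw [← inner_featureMap, inner_meanDiscrepancy]
  simp only [featureMap_apply]

lemma norm_meanDiscrepancy_le {R : ℝ} (hR : ∀ x : X, ‖featureMap H x‖ ≤ R) {B : ℝ} {k l : ℕ}
    (hk : 0 < k) (hl : 0 < l) {bhat : (Fin k → X) × (Fin l → X) → Fin k → ℝ}
    (hb : ∀ p j, bhat p j ∈ Icc 0 B) (p : (Fin k → X) × (Fin l → X)) :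
    ‖meanDiscrepancy H bhat p‖ ≤ B * R + R := by
  refine (norm_sub_le _ _).trans (add_le_add ?_ ?_)
  · rw [norm_smul, Real.norm_eq_abs, abs_of_nonneg (by positivity)]
    refine (mul_le_mul_of_nonneg_left (norm_sum_le _ _) (by positivity)).trans
      (mean_le_of_le hk fun j => ?_)
    rw [norm_smul, Real.norm_eq_abs, abs_of_nonneg (hb p j).1]
    exact mul_le_mul (hb p j).2 (hR _) (norm_nonneg _) ((hb p j).1.trans (hb p j).2)
  · rw [norm_smul, Real.norm_eq_abs, abs_of_nonneg (by positivity)]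
    exact (mul_le_mul_of_nonneg_left (norm_sum_le _ _) (by positivity)).trans
      (mean_le_of_le hl fun j => hR _)

/-- The squared error at `x` of the noiseless ridge fit at the design `w`. -/
noncomputable def fitError (H : Type*) [NormedAddCommGroup H]
    [InnerProductSpace ℝ H] [CompleteSpace H] [RKHS ℝ H X ℝ] (lam : ℝ) (G : X → ℝ) {m : ℕ}
    (p : (Fin m → X) × X) : ℝ :=
  (ridgeFit H lam p.1 (fun j => G (p.1 j)) p.2 - G p.2) ^ 2

lemma norm_fitError_le {R : ℝ} (hR : ∀ x : X, ‖featureMap H x‖ ≤ R)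
    {G : X → ℝ} (hG1 : ∀ x, |G x| ≤ 1) {lam : ℝ} (hlam : 0 < lam) {m : ℕ} (p : (Fin m → X) × X) :
    ‖fitError H lam G p‖ ≤ (√(m / lam) * R + 1) ^ 2 := by
  rw [fitError, norm_pow]
  refine pow_le_pow_left₀ (norm_nonneg _) ((norm_sub_le _ _).trans (add_le_add ?_ (hG1 _))) 2
  have := abs_ridgeFit_apply_le (H := H) hR hlam p.1 (t := fun j => G (p.1 j)) (fun _ => hG1 _) p.2
  rwa [Fintype.card_fin] at this

end ErrorQuantities

/-! ### Second moments of the noise terms and of the fit error. -/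

section ErrorTerms

variable {X : Type*} [MeasurableSpace X] {H : Type*} [NormedAddCommGroup H]
  [InnerProductSpace ℝ H] [CompleteSpace H] [RKHS ℝ H X ℝ]

lemma measurePreserving_covariates (μ : Measure X) [IsProbabilityMeasure μ] (κ : Kernel X ℝ)
    [IsMarkovKernel κ] {Ω : Type*} [MeasurableSpace Ω] (P : Measure Ω) [IsProbabilityMeasure P]
    {ι ι' : Type*} [Fintype ι] [DecidableEq ι] [Fintype ι'] {e : ι' → ι}
    (he : Function.Injective e) :
    MeasurePreserving (fun s : (ι → X × ℝ) × Ω => ((fun j => (s.1 (e j)).1, s.2) : (ι' → X) × Ω))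
      ((Measure.pi fun _ : ι => μ ⊗ₘ κ).prod P) ((Measure.pi fun _ : ι' => μ).prod P) := by
  have h1 : MeasurePreserving (fun (s : ι → X × ℝ) i => (s i).1) (Measure.pi fun _ => μ ⊗ₘ κ)
      (Measure.pi fun _ => μ) :=
    measurePreserving_pi (fun _ : ι => μ ⊗ₘ κ) (fun _ => μ)
      (fun i => ⟨measurable_fst, Measure.fst_compProd μ κ⟩)
  have h2 := (measurePreserving_comp_injective μ he).comp h1
  exact h2.prod (MeasurePreserving.id P)

/-- The label noise in the weighted part of the estimator. -/
lemma integral_weighted_noise_sq_le {κ : Kernel X ℝ} [IsMarkovKernel κ]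
    (hκ : ∀ x, ∀ᵐ y ∂(κ x), y ∈ Icc (0 : ℝ) 1) (μ μ' : Measure X) [IsProbabilityMeasure μ]
    [IsProbabilityMeasure μ'] {B : ℝ} {n k l : ℕ} (hk : 0 < k) {e : Fin k → Fin n}
    (he : Function.Injective e) {bhat : (Fin k → X) × (Fin l → X) → Fin k → ℝ}
    (hbm : Measurable bhat) (hb : ∀ p j, bhat p j ∈ Icc 0 B) :
    Integrable (fun s => ((1 / (k : ℝ)) * ∑ j, bhat (fun j => (s.1 (e j)).1, s.2) j *
        noise κ (s.1 (e j))) ^ 2) (sampleLaw μ μ' κ n l) ∧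
    ∫ s, ((1 / (k : ℝ)) * ∑ j, bhat (fun j => (s.1 (e j)).1, s.2) j *
        noise κ (s.1 (e j))) ^ 2 ∂(sampleLaw μ μ' κ n l) ≤ B ^ 2 / k := by
  have hk' : (0 : ℝ) < k := Nat.cast_pos.2 hk
  have ham : ∀ j, Measurable fun p : (Fin n → X) × (Fin l → X) =>
      (1 / (k : ℝ)) * bhat (fun j => p.1 (e j), p.2) j := fun j => by
    have h1 : Measurable fun p : (Fin n → X) × (Fin l → X) =>
        ((fun j => p.1 (e j), p.2) : (Fin k → X) × (Fin l → X)) :=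
      (measurable_pi_lambda _ fun j => (measurable_pi_apply _).comp measurable_fst).prodMk
        measurable_snd
    exact ((measurable_pi_apply j).comp (hbm.comp h1)).const_mul _
  have hab : ∀ j (p : (Fin n → X) × (Fin l → X)),
      |(1 / (k : ℝ)) * bhat (fun j => p.1 (e j), p.2) j| ≤ 1 / k * B := fun j p => by
    rw [abs_of_nonneg (mul_nonneg (by positivity) (hb _ _).1)]
    exact mul_le_mul_of_nonneg_left (hb _ _).2 (by positivity)
  have h := integral_sum_noise_mul_sq_le hκ μ (Measure.pi fun _ : Fin l => μ') he ham hab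
  have heq : ∀ s : (Fin n → X × ℝ) × (Fin l → X),
      (1 / (k : ℝ)) * ∑ j, bhat (fun j => (s.1 (e j)).1, s.2) j * noise κ (s.1 (e j)) =
      ∑ j, noise κ (s.1 (e j)) * ((1 / (k : ℝ)) * bhat (fun j => (s.1 (e j)).1, s.2) j) :=
    fun s => by
      rw [Finset.mul_sum]
      exact Finset.sum_congr rfl fun j _ => by ring
  simp only [heq]
  refine ⟨h.1, h.2.trans ?_⟩
  calc _ ≤ ∫ _, B ^ 2 / k ∂((Measure.pi fun _ : Fin n => μ).prod (Measure.pi fun _ : Fin l => μ')) := by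
        refine integral_mono_of_nonneg
          (Filter.Eventually.of_forall fun s => Finset.sum_nonneg fun j _ => sq_nonneg _)
          (integrable_const _) (Filter.Eventually.of_forall fun s => ?_)
        calc _ ≤ ∑ _j : Fin k, (1 / (k : ℝ) * B) ^ 2 := Finset.sum_le_sum fun j _ => by
              rw [← sq_abs]; exact pow_le_pow_left₀ (abs_nonneg _) (hab j s) 2
          _ = B ^ 2 / k := by
              simp only [Finset.sum_const, Finset.card_univ, Fintype.card_fin, nsmul_eq_mul]
              field_simp
    _ = _ := by simp

/-- The label noise entering through the regression fit. -/
lemma integral_inner_ridgeFit_noise_sq_le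
    (hK : Measurable (Function.uncurry (kernelFun H : X → X → ℝ))) {R : ℝ}
    (hR : ∀ x : X, ‖featureMap H x‖ ≤ R) {κ : Kernel X ℝ} [IsMarkovKernel κ]
    (hκ : ∀ x, ∀ᵐ y ∂(κ x), y ∈ Icc (0 : ℝ) 1) {μ μ' : Measure X} [IsProbabilityMeasure μ]
    [IsProbabilityMeasure μ'] {B : ℝ} {b : X → ℝ} (hbetam : Measurable b)
    (hbeta : ∀ x, b x ∈ Icc 0 B) (hd : ∀ f : X → ℝ, ∫ x, f x ∂μ' = ∫ x, b x * f x ∂μ)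
    {n k l m : ℕ} (hk : 0 < k) (hl : 0 < l) {e : Fin k → Fin n} (he : Function.Injective e)
    {e' : Fin m → Fin n} (he' : Function.Injective e')
    {bhat : (Fin k → X) × (Fin l → X) → Fin k → ℝ} (hbhat : IsKMMSolver H B bhat) {lam : ℝ}
    (hlam : 0 < lam) :
    Integrable (fun s => (inner ℝ (meanDiscrepancy H bhat (fun j => (s.1 (e j)).1, s.2))
        (ridgeFit H lam (fun j => (s.1 (e' j)).1) (fun j => noise κ (s.1 (e' j)))) : ℝ) ^ 2)
      (sampleLaw μ μ' κ n l) ∧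
    ∫ s, (inner ℝ (meanDiscrepancy H bhat (fun j => (s.1 (e j)).1, s.2))
        (ridgeFit H lam (fun j => (s.1 (e' j)).1) (fun j => noise κ (s.1 (e' j)))) : ℝ) ^ 2
      ∂(sampleLaw μ μ' κ n l) ≤
      (2 * (((B + 1) * R) ^ 2 / k) + 2 * ((2 * R) ^ 2 / l)) / (4 * lam) := by
  have hb : ∀ p j, bhat p j ∈ Icc 0 B := fun p j => (hbhat.2 p.1 p.2).1 j
  have hsel : MeasurePreserving (fun p : (Fin n → X) × (Fin l → X) =>
      ((fun j => p.1 (e j), p.2) : (Fin k → X) × (Fin l → X)))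
      ((Measure.pi fun _ => μ).prod (Measure.pi fun _ => μ'))
      ((Measure.pi fun _ => μ).prod (Measure.pi fun _ => μ')) :=
    (measurePreserving_comp_injective μ he).prod (MeasurePreserving.id _)
  let a : Fin m → (Fin n → X) × (Fin l → X) → ℝ := fun i p =>
    ridgeCoef H lam (fun j => p.1 (e' j))
      (fun j => meanDiscrepancy H bhat (fun j => p.1 (e j), p.2) (p.1 (e' j))) i
  have hx : ∀ i : Fin n, Measurable fun p : (Fin n → X) × (Fin l → X) => p.1 i := fun i =>
    (measurable_pi_apply i).comp measurable_fst
  have hz : ∀ i : Fin l, Measurable fun p : (Fin n → X) × (Fin l → X) => p.2 i := fun i =>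
    (measurable_pi_apply i).comp measurable_snd
  have hDm : ∀ j : Fin m, Measurable fun p : (Fin n → X) × (Fin l → X) =>
      meanDiscrepancy H bhat (fun j => p.1 (e j), p.2) (p.1 (e' j)) := fun j => by
    simp only [meanDiscrepancy_apply]
    refine Measurable.sub (Measurable.const_mul (Finset.measurable_sum _ fun i _ => ?_) _)
      (Measurable.const_mul (Finset.measurable_sum _ fun i _ => ?_) _)
    · exact ((measurable_pi_apply i).comp (hbhat.1.comp hsel.measurable)).mul
        (measurable_kernelFun_comp hK (hx _) (hx _))
    · exact measurable_kernelFun_comp hK (hx _) (hz _)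
  have ham : ∀ i, Measurable (a i) := fun i =>
    measurable_ridgeCoef hK lam (measurable_pi_lambda _ fun j => hx _)
      (measurable_pi_lambda _ hDm) i
  have hsum : ∀ p, ∑ i, a i p ^ 2 ≤
      ‖meanDiscrepancy H bhat (fun j => p.1 (e j), p.2)‖ ^ 2 / (4 * lam) := fun p =>
    sum_ridgeCoef_sq_le hlam _ _
  -- A deterministic bound, needed only for integrability; the rate comes from `hsum` and optimality
  -- of the weights.
  have hab : ∀ i p, |a i p| ≤ √((B * R + R) ^ 2 / (4 * lam)) := fun i p => by
    refine Real.abs_le_sqrt ((Finset.single_le_sum (f := fun i => a i p ^ 2)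
      (fun i _ => sq_nonneg _) (Finset.mem_univ i)).trans ((hsum p).trans ?_))
    gcongr
    exact norm_meanDiscrepancy_le hR hk hl hb _
  have h := integral_sum_noise_mul_sq_le hκ μ (Measure.pi fun _ : Fin l => μ') he' ham hab
  have heq : ∀ s : (Fin n → X × ℝ) × (Fin l → X),
      (inner ℝ (meanDiscrepancy H bhat (fun j => (s.1 (e j)).1, s.2))
        (ridgeFit H lam (fun j => (s.1 (e' j)).1) (fun j => noise κ (s.1 (e' j)))) : ℝ) =
      ∑ i, noise κ (s.1 (e' i)) * a i (fun i => (s.1 i).1, s.2) := fun s => by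
    rw [inner_ridgeFit hlam]
    exact Finset.sum_congr rfl fun i _ => mul_comm _ _
  simp only [heq]
  refine ⟨h.1, h.2.trans ?_⟩
  obtain ⟨q, hqm, hqi, hq, hqb⟩ := exists_integrable_kmmObjective_bound hK hR hbetam hbeta hd hk hl
  have hqi' := (hsel.integrable_comp_of_integrable hqi).div_const (4 * lam)
  calc _ ≤ ∫ p : (Fin n → X) × (Fin l → X), q (fun j => p.1 (e j), p.2) / (4 * lam)
          ∂((Measure.pi fun _ => μ).prod (Measure.pi fun _ => μ')) := by
        refine integral_mono_of_nonneg
          (Filter.Eventually.of_forall fun s => Finset.sum_nonneg fun j _ => sq_nonneg _)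
          hqi' (Filter.Eventually.of_forall fun p => (hsum p).trans ?_)
        refine div_le_div_of_nonneg_right ?_ (by positivity)
        -- The true density values are feasible, so the optimal discrepancy is at most theirs.
        have hmin := (hbhat.2 (fun j => p.1 (e j)) p.2).2
          (show (fun j => b (p.1 (e j))) ∈ {b' : Fin k → ℝ | ∀ j, b' j ∈ Icc 0 B} from
            fun j => hbeta _)
        exact le_trans hmin (hq (fun j => p.1 (e j), p.2))
    _ = (∫ p, q p ∂((Measure.pi fun _ => μ).prod (Measure.pi fun _ => μ'))) / (4 * lam) := by
        rw [integral_div]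
        congr 1
        exact integral_comp_measurePreserving hsel hqm
    _ ≤ _ := by gcongr

lemma measurable_fitError (hK : Measurable (Function.uncurry (kernelFun H : X → X → ℝ)))
    {G : X → ℝ} (hG : Measurable G) (lam : ℝ) {m : ℕ} :
    Measurable (fitError H lam G : (Fin m → X) × X → ℝ) := by
  refine Measurable.pow_const (Measurable.sub ?_ (hG.comp measurable_snd)) 2
  exact measurable_ridgeFit hK lam measurable_fst
    (measurable_pi_lambda _ fun j => hG.comp ((measurable_pi_apply j).comp measurable_fst))
    measurable_snd

lemma integrable_fitError (hK : Measurable (Function.uncurry (kernelFun H : X → X → ℝ))) {R : ℝ}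
    (hR : ∀ x : X, ‖featureMap H x‖ ≤ R) {G : X → ℝ} (hG : Measurable G) (hG1 : ∀ x, |G x| ≤ 1)
    {lam : ℝ} (hlam : 0 < lam) {m : ℕ} (P : Measure ((Fin m → X) × X)) [IsProbabilityMeasure P] :
    Integrable (fitError H lam G) P :=
  Integrable.of_bound (measurable_fitError hK hG lam).aestronglyMeasurable _
    (Filter.Eventually.of_forall fun p => norm_fitError_le hR hG1 hlam p)

lemma integral_fitError_le (hK : Measurable (Function.uncurry (kernelFun H : X → X → ℝ))) {R : ℝ}
    (hR : ∀ x : X, ‖featureMap H x‖ ≤ R) (μ : Measure X) [IsProbabilityMeasure μ] {G : X → ℝ}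
    (hG : Measurable G) (hG1 : ∀ x, |G x| ≤ 1) {lam : ℝ} (hlam : 0 < lam) (m : ℕ) (h : H) :
    ∫ p, fitError H lam G p ∂((Measure.pi fun _ : Fin m => μ).prod μ) ≤
      (1 + R ^ 2 / lam) ^ 2 * (∫ x, (h x - G x) ^ 2 ∂μ + lam / (m + 1) * ‖h‖ ^ 2) := by
  have hp : MeasurePreserving (fun x : Fin (m + 1) → X => ((fun j => x j.succ, x 0) :
      (Fin m → X) × X)) (Measure.pi fun _ => μ) ((Measure.pi fun _ : Fin m => μ).prod μ) :=
    Measure.measurePreserving_swap.comp (measurePreserving_piFinSuccAbove (fun _ => μ) 0)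
  rw [← integral_comp_measurePreserving hp (measurable_fitError hK hG lam)]
  exact integral_ridgeFit_succ_sub_sq_le hK hR μ hG hG1 hlam m h

/-- For a fixed design, the change of law at the evaluation point costs at most the density bound
`B`. -/
lemma integral_fitError_test_le (hK : Measurable (Function.uncurry (kernelFun H : X → X → ℝ)))
    {R : ℝ} (hR : ∀ x : X, ‖featureMap H x‖ ≤ R) {μ μ' : Measure X} [IsProbabilityMeasure μ]
    [IsProbabilityMeasure μ'] {B : ℝ} {b : X → ℝ}
    (hbeta : ∀ x, b x ∈ Icc 0 B) (hd : ∀ f : X → ℝ, ∫ x, f x ∂μ' = ∫ x, b x * f x ∂μ)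
    {G : X → ℝ} (hG : Measurable G) (hG1 : ∀ x, |G x| ≤ 1) {lam : ℝ} (hlam : 0 < lam) (m : ℕ) :
    ∫ p, fitError H lam G p ∂((Measure.pi fun _ : Fin m => μ).prod μ') ≤
      B * ∫ p, fitError H lam G p ∂((Measure.pi fun _ : Fin m => μ).prod μ) := by
  have hi := integrable_fitError hK hR hG hG1 hlam ((Measure.pi fun _ : Fin m => μ).prod μ)
  have hi' := integrable_fitError hK hR hG hG1 hlam ((Measure.pi fun _ : Fin m => μ).prod μ')
  rw [integral_prod _ hi, integral_prod _ hi', ← integral_const_mul]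
  refine integral_mono hi'.integral_prod_left (hi.integral_prod_left.const_mul B) fun w => ?_
  refine integral_le_mul_integral_of_density hbeta hd (fun x => sq_nonneg _) ?_
  refine Integrable.of_bound
    ((measurable_fitError hK hG lam).comp measurable_prodMk_left).aestronglyMeasurable _
    (Filter.Eventually.of_forall fun x => norm_fitError_le hR hG1 hlam (w, x))

end ErrorTerms

/-! ### Bias terms and the five-term error decomposition. -/

section ErrorBound

variable {X : Type*} [MeasurableSpace X]

lemma targetMean_eq {κ : Kernel X ℝ} [IsMarkovKernel κ]
    (hκ : ∀ x, ∀ᵐ y ∂(κ x), y ∈ Icc (0 : ℝ) 1) (μ : Measure X) [IsProbabilityMeasure μ] :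
    targetMean μ κ = ∫ x, regressionFun κ x ∂μ := by
  rw [targetMean, Measure.integral_compProd]
  · rfl
  · refine Integrable.of_bound measurable_snd.aestronglyMeasurable 1 ?_
    filter_upwards [ae_label_mem_Icc hκ μ] with p hp
    rw [Real.norm_eq_abs, abs_le]
    exact ⟨by linarith [hp.1], hp.2⟩

/-- The mean squared error of the empirical mean of a `[0, 1]`-valued function. -/
lemma integral_mean_sub_integral_sq_le (μ : Measure X) [IsProbabilityMeasure μ] {G : X → ℝ}
    (hG : Measurable G) (hG1 : ∀ x, G x ∈ Icc (0 : ℝ) 1) {l : ℕ} (hl : 0 < l) :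
    Integrable (fun z : Fin l → X => ((1 / (l : ℝ)) * ∑ i, G (z i) - ∫ x, G x ∂μ) ^ 2)
      (Measure.pi fun _ => μ) ∧
    ∫ z, ((1 / (l : ℝ)) * ∑ i, G (z i) - ∫ x, G x ∂μ) ^ 2 ∂(Measure.pi fun _ : Fin l => μ) ≤
      1 / (l : ℝ) := by
  have hl' : (0 : ℝ) < l := Nat.cast_pos.2 hl
  set ν := ∫ x, G x ∂μ with hν
  have hGi : Integrable G μ := Integrable.of_bound hG.aestronglyMeasurable 1
    (Filter.Eventually.of_forall fun x => by
      rw [Real.norm_eq_abs, abs_of_nonneg (hG1 x).1]; exact (hG1 x).2)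
  have hν0 : 0 ≤ ν := integral_nonneg fun x => (hG1 x).1
  have hν1 : ν ≤ 1 := by
    calc ν ≤ ∫ _, (1 : ℝ) ∂μ := integral_mono hGi (integrable_const _) fun x => (hG1 x).2
      _ = 1 := by simp
  have hc : ∀ x, ‖G x - ν‖ ≤ 1 := fun x => by
    rw [Real.norm_eq_abs, abs_le]
    exact ⟨by linarith [(hG1 x).1], by linarith [(hG1 x).2]⟩
  have h := integral_norm_sum_sq_le (ι := Fin l) μ (V := fun x => G x - ν) hc
    (by
      have h1 : Measurable fun p : X × X => G p.1 - ν := (hG.comp measurable_fst).sub_const _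
      have h2 : Measurable fun p : X × X => G p.2 - ν := (hG.comp measurable_snd).sub_const _
      exact h2.mul h1)
    (fun x => by
      simp only [RCLike.inner_apply, conj_trivial]
      rw [integral_const_mul, integral_sub hGi (integrable_const _)]
      simp [hν])
  have heq : ∀ z : Fin l → X, ((1 / (l : ℝ)) * ∑ i, G (z i) - ν) ^ 2 =
      (1 / (l : ℝ)) ^ 2 * ‖∑ i, (G (z i) - ν)‖ ^ 2 := fun z => by
    rw [Real.norm_eq_abs, sq_abs, ← mul_pow]
    congr 1
    rw [Finset.sum_sub_distrib, mul_sub]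
    simp only [Finset.sum_const, Finset.card_univ, Fintype.card_fin, nsmul_eq_mul]
    field_simp
  simp only [heq]
  constructor
  · refine (Integrable.of_bound h.1.aestronglyMeasurable ((l : ℝ) ^ 2)
      (Filter.Eventually.of_forall fun z => ?_)).const_mul _
    rw [norm_pow, norm_norm]
    refine pow_le_pow_left₀ (norm_nonneg _) ((norm_sum_le _ _).trans ?_) 2
    calc ∑ i, ‖G (z i) - ν‖ ≤ ∑ _i : Fin l, (1 : ℝ) := Finset.sum_le_sum fun i _ => hc _
      _ = l := by simp
  · rw [integral_const_mul]
    refine (mul_le_mul_of_nonneg_left h.2 (sq_nonneg _)).trans (le_of_eq ?_)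
    rw [Fintype.card_fin]
    field_simp

lemma integrable_of_sq_le {Ω : Type*} [MeasurableSpace Ω] {P : Measure Ω} {f g : Ω → ℝ}
    (hf : Measurable f) (hg : Integrable g P) (hfg : ∀ ω, f ω ^ 2 ≤ g ω) :
    Integrable (fun ω => f ω ^ 2) P ∧ ∫ ω, f ω ^ 2 ∂P ≤ ∫ ω, g ω ∂P := by
  have h1 : Integrable (fun ω => f ω ^ 2) P :=
    hg.mono' (hf.pow_const 2).aestronglyMeasurable (Filter.Eventually.of_forall fun ω => by
      rw [Real.norm_eq_abs, abs_of_nonneg (sq_nonneg _)]; exact hfg ω)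
  exact ⟨h1, integral_mono h1 hg hfg⟩

variable {H : Type*} [NormedAddCommGroup H] [InnerProductSpace ℝ H] [CompleteSpace H]
  [RKHS ℝ H X ℝ]

/-- The bias of the weighted training part. -/
lemma integral_weighted_bias_sq_le (hK : Measurable (Function.uncurry (kernelFun H : X → X → ℝ)))
    {R : ℝ} (hR : ∀ x : X, ‖featureMap H x‖ ≤ R) (κ : Kernel X ℝ) [IsMarkovKernel κ]
    (μ μ' : Measure X) [IsProbabilityMeasure μ] [IsProbabilityMeasure μ'] {B : ℝ}
    {G : X → ℝ} (hG : Measurable G) (hG1 : ∀ x, |G x| ≤ 1) {n k l m : ℕ} (hk : 0 < k)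
    {e : Fin k → Fin n} {e' : Fin m → Fin n}
    (he' : Function.Injective e') (hdisj : ∀ j i, e j ≠ e' i)
    {bhat : (Fin k → X) × (Fin l → X) → Fin k → ℝ} (hbm : Measurable bhat)
    (hb : ∀ p j, bhat p j ∈ Icc 0 B) {lam : ℝ} (hlam : 0 < lam) :
    let t : (Fin n → X × ℝ) × (Fin l → X) → ℝ := fun s =>
      (1 / (k : ℝ)) * ∑ j, bhat (fun j => (s.1 (e j)).1, s.2) j * (G (s.1 (e j)).1 -
        ridgeFit H lam (fun i => (s.1 (e' i)).1) (fun i => G (s.1 (e' i)).1) (s.1 (e j)).1)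
    Measurable t ∧ Integrable (fun s => t s ^ 2) (sampleLaw μ μ' κ n l) ∧
    ∫ s, t s ^ 2 ∂(sampleLaw μ μ' κ n l) ≤
      B ^ 2 * ∫ p, fitError H lam G p ∂((Measure.pi fun _ : Fin m => μ).prod μ) := by
  intro t
  have hk' : (0 : ℝ) < k := Nat.cast_pos.2 hk
  have hx : ∀ i : Fin n, Measurable fun s : (Fin n → X × ℝ) × (Fin l → X) => (s.1 i).1 := fun i =>
    measurable_fst.comp ((measurable_pi_apply i).comp measurable_fst)
  have hsel : Measurable fun s : (Fin n → X × ℝ) × (Fin l → X) =>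
      ((fun j => (s.1 (e j)).1, s.2) : (Fin k → X) × (Fin l → X)) :=
    (measurable_pi_lambda _ fun j => hx _).prodMk measurable_snd
  have htm : Measurable t := by
    refine Measurable.const_mul (Finset.measurable_sum _ fun j _ => ?_) _
    refine ((measurable_pi_apply j).comp (hbm.comp hsel)).mul ((hG.comp (hx _)).sub ?_)
    exact measurable_ridgeFit hK lam (measurable_pi_lambda _ fun i => hx _)
      (measurable_pi_lambda _ fun i => hG.comp (hx _)) (hx _)
  have hp : ∀ j : Fin k, MeasurePreserving (fun s : (Fin n → X × ℝ) × (Fin l → X) =>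
      ((fun i => (s.1 (e' i)).1, (s.1 (e j)).1) : (Fin m → X) × X)) (sampleLaw μ μ' κ n l)
      ((Measure.pi fun _ : Fin m => μ).prod μ) := fun j => by
    -- Sample splitting: the evaluation index differs from all design indices, so the pair has the
    -- law of an independent design and fresh point.
    have h1 : Function.Injective (Fin.cons (e j) e' : Fin (m + 1) → Fin n) :=
      Fin.cons_injective_iff.2 ⟨fun ⟨i, hi⟩ => hdisj j i hi.symm, he'⟩
    have h2 := measurePreserving_covariates μ κ (Measure.pi fun _ : Fin l => μ') h1
    have h3 : MeasurePreserving (fun x : Fin (m + 1) → X => ((fun j => x j.succ, x 0) :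
        (Fin m → X) × X)) (Measure.pi fun _ => μ) ((Measure.pi fun _ : Fin m => μ).prod μ) :=
      Measure.measurePreserving_swap.comp (measurePreserving_piFinSuccAbove (fun _ => μ) 0)
    exact h3.comp (measurePreserving_fst.comp h2)
  have hfi := integrable_fitError hK hR hG hG1 hlam ((Measure.pi fun _ : Fin m => μ).prod μ)
  let q : (Fin n → X × ℝ) × (Fin l → X) → ℝ := fun s => B ^ 2 * ((1 / (k : ℝ)) * ∑ j,
    fitError H lam G ((fun i => (s.1 (e' i)).1, (s.1 (e j)).1) : (Fin m → X) × X))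
  have hji : ∀ j : Fin k, Integrable (fun s : (Fin n → X × ℝ) × (Fin l → X) =>
      fitError H lam G ((fun i => (s.1 (e' i)).1, (s.1 (e j)).1) : (Fin m → X) × X))
      (sampleLaw μ μ' κ n l) := fun j => (hp j).integrable_comp_of_integrable hfi
  have hqi : Integrable q (sampleLaw μ μ' κ n l) :=
    ((integrable_finsetSum _ fun j _ => hji j).const_mul _).const_mul _
  have hq : ∫ s, q s ∂(sampleLaw μ μ' κ n l) =
      B ^ 2 * ∫ p, fitError H lam G p ∂((Measure.pi fun _ : Fin m => μ).prod μ) := by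
    simp only [q]
    rw [integral_const_mul, integral_const_mul, integral_finsetSum _ fun j _ => hji j]
    rw [Finset.sum_congr rfl fun j _ =>
      integral_comp_measurePreserving (hp j) (measurable_fitError hK hG lam)]
    simp only [Finset.sum_const, Finset.card_univ, Fintype.card_fin, nsmul_eq_mul]
    field_simp
  refine ⟨htm, ?_⟩
  rw [← hq]
  -- The weights depend on the evaluation points, so they are bounded by `B` pointwise, before any
  -- expectation is taken.
  refine integrable_of_sq_le htm hqi fun s => ?_
  refine (sq_mean_le_mean_sq hk _).trans ?_
  simp only [q]
  rw [mul_left_comm, Finset.mul_sum _ _ (B ^ 2)]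
  refine mul_le_mul_of_nonneg_left (Finset.sum_le_sum fun j _ => ?_) (one_div_nonneg.2 hk'.le)
  rw [mul_pow, fitError, ← neg_sub, neg_sq]
  exact mul_le_mul_of_nonneg_right (pow_le_pow_left₀ (hb _ _).1 (hb _ _).2 2) (sq_nonneg _)

/-- The bias of the test part. -/
lemma integral_test_bias_sq_le (hK : Measurable (Function.uncurry (kernelFun H : X → X → ℝ)))
    {R : ℝ} (hR : ∀ x : X, ‖featureMap H x‖ ≤ R) (κ : Kernel X ℝ) [IsMarkovKernel κ]
    (μ μ' : Measure X) [IsProbabilityMeasure μ] [IsProbabilityMeasure μ']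
    {G : X → ℝ} (hG : Measurable G) (hG1 : ∀ x, |G x| ≤ 1) {n l m : ℕ} (hl : 0 < l)
    {e' : Fin m → Fin n} (he' : Function.Injective e') {lam : ℝ} (hlam : 0 < lam) :
    let t : (Fin n → X × ℝ) × (Fin l → X) → ℝ := fun s =>
      (1 / (l : ℝ)) * ∑ i,
        (ridgeFit H lam (fun i => (s.1 (e' i)).1) (fun i => G (s.1 (e' i)).1) (s.2 i) - G (s.2 i))
    Measurable t ∧ Integrable (fun s => t s ^ 2) (sampleLaw μ μ' κ n l) ∧
    ∫ s, t s ^ 2 ∂(sampleLaw μ μ' κ n l) ≤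
      ∫ p, fitError H lam G p ∂((Measure.pi fun _ : Fin m => μ).prod μ') := by
  intro t
  have hl' : (0 : ℝ) < l := Nat.cast_pos.2 hl
  have hx : ∀ i : Fin n, Measurable fun s : (Fin n → X × ℝ) × (Fin l → X) => (s.1 i).1 := fun i =>
    measurable_fst.comp ((measurable_pi_apply i).comp measurable_fst)
  have hz : ∀ i : Fin l, Measurable fun s : (Fin n → X × ℝ) × (Fin l → X) => s.2 i := fun i =>
    (measurable_pi_apply i).comp measurable_snd
  have htm : Measurable t := by
    refine Measurable.const_mul (Finset.measurable_sum _ fun j _ => ?_) _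
    refine Measurable.sub ?_ (hG.comp (hz _))
    exact measurable_ridgeFit hK lam (measurable_pi_lambda _ fun i => hx _)
      (measurable_pi_lambda _ fun i => hG.comp (hx _)) (hz _)
  have hp : ∀ i : Fin l, MeasurePreserving (fun s : (Fin n → X × ℝ) × (Fin l → X) =>
      ((fun i => (s.1 (e' i)).1, s.2 i) : (Fin m → X) × X)) (sampleLaw μ μ' κ n l)
      ((Measure.pi fun _ : Fin m => μ).prod μ') := fun i => by
    have h2 := measurePreserving_covariates μ κ (Measure.pi fun _ : Fin l => μ') he'
    have h3 := (MeasurePreserving.id (Measure.pi fun _ : Fin m => μ)).prod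
      (measurePreserving_eval (fun _ : Fin l => μ') i)
    exact h3.comp h2
  have hfi := integrable_fitError hK hR hG hG1 hlam ((Measure.pi fun _ : Fin m => μ).prod μ')
  let q : (Fin n → X × ℝ) × (Fin l → X) → ℝ := fun s => (1 / (l : ℝ)) * ∑ i,
    fitError H lam G ((fun i => (s.1 (e' i)).1, s.2 i) : (Fin m → X) × X)
  have hji : ∀ i : Fin l, Integrable (fun s : (Fin n → X × ℝ) × (Fin l → X) =>
      fitError H lam G ((fun i => (s.1 (e' i)).1, s.2 i) : (Fin m → X) × X))
      (sampleLaw μ μ' κ n l) := fun i => (hp i).integrable_comp_of_integrable hfi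
  have hqi : Integrable q (sampleLaw μ μ' κ n l) :=
    (integrable_finsetSum _ fun j _ => hji j).const_mul _
  have hq : ∫ s, q s ∂(sampleLaw μ μ' κ n l) =
      ∫ p, fitError H lam G p ∂((Measure.pi fun _ : Fin m => μ).prod μ') := by
    simp only [q]
    rw [integral_const_mul, integral_finsetSum _ fun j _ => hji j]
    rw [Finset.sum_congr rfl fun j _ =>
      integral_comp_measurePreserving (hp j) (measurable_fitError hK hG lam)]
    simp only [Finset.sum_const, Finset.card_univ, Fintype.card_fin, nsmul_eq_mul]
    field_simp
  refine ⟨htm, ?_⟩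
  rw [← hq]
  exact integrable_of_sq_le htm hqi fun s => sq_mean_le_mean_sq hl _

lemma sq_add_five_le (a b c d e : ℝ) :
    (a + b + c + d + e) ^ 2 ≤ 5 * (a ^ 2 + b ^ 2 + c ^ 2 + d ^ 2 + e ^ 2) := by
  nlinarith [sq_nonneg (a - b), sq_nonneg (a - c), sq_nonneg (a - d), sq_nonneg (a - e),
    sq_nonneg (b - c), sq_nonneg (b - d), sq_nonneg (b - e), sq_nonneg (c - d), sq_nonneg (c - e),
    sq_nonneg (d - e)]

lemma integral_add_five_sq_le {Ω : Type*} [MeasurableSpace Ω] {P : Measure Ω}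
    {f₁ f₂ f₃ f₄ f₅ W : Ω → ℝ} (hW : Measurable W) {c₁ c₂ c₃ c₄ c₅ : ℝ}
    (i₁ : Integrable (fun s => f₁ s ^ 2) P) (i₂ : Integrable (fun s => f₂ s ^ 2) P)
    (i₃ : Integrable (fun s => f₃ s ^ 2) P) (i₄ : Integrable (fun s => f₄ s ^ 2) P)
    (i₅ : Integrable (fun s => f₅ s ^ 2) P) (b₁ : ∫ s, f₁ s ^ 2 ∂P ≤ c₁)
    (b₂ : ∫ s, f₂ s ^ 2 ∂P ≤ c₂) (b₃ : ∫ s, f₃ s ^ 2 ∂P ≤ c₃) (b₄ : ∫ s, f₄ s ^ 2 ∂P ≤ c₄)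
    (b₅ : ∫ s, f₅ s ^ 2 ∂P ≤ c₅) (hdec : ∀ s, W s = f₁ s + f₂ s + f₃ s + f₄ s + f₅ s) :
    Integrable (fun s => W s ^ 2) P ∧ ∫ s, W s ^ 2 ∂P ≤ 5 * (c₁ + c₂ + c₃ + c₄ + c₅) := by
  have h := integrable_of_sq_le hW (((((i₁.add i₂).add i₃).add i₄).add i₅).const_mul 5) fun s => by
    rw [hdec]; exact sq_add_five_le _ _ _ _ _
  refine ⟨h.1, h.2.trans ?_⟩
  rw [integral_const_mul, integral_add' (((i₁.add i₂).add i₃).add i₄) i₅,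
    integral_add' ((i₁.add i₂).add i₃) i₄, integral_add' (i₁.add i₂) i₃, integral_add' i₁ i₂]
  linarith

/-- The mean squared error of the robust estimator with a ridge fit on an independent part of the
training sample. -/
lemma integral_estimator_sub_sq_le (hK : Measurable (Function.uncurry (kernelFun H : X → X → ℝ)))
    {R : ℝ} (hR : ∀ x : X, ‖featureMap H x‖ ≤ R) {κ : Kernel X ℝ} [IsMarkovKernel κ]
    (hκ : ∀ x, ∀ᵐ y ∂(κ x), y ∈ Icc (0 : ℝ) 1) {μ μ' : Measure X} [IsProbabilityMeasure μ]
    [IsProbabilityMeasure μ'] {B : ℝ} (hB0 : 0 ≤ B) {b : X → ℝ} (hbetam : Measurable b)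
    (hbeta : ∀ x, b x ∈ Icc 0 B) (hd : ∀ f : X → ℝ, ∫ x, f x ∂μ' = ∫ x, b x * f x ∂μ)
    {n k l m : ℕ} (hk : 0 < k) (hl : 0 < l) {e : Fin k → Fin n} (he : Function.Injective e)
    {e' : Fin m → Fin n} (he' : Function.Injective e') (hdisj : ∀ j i, e j ≠ e' i)
    {bhat : (Fin k → X) × (Fin l → X) → Fin k → ℝ} (hbhat : IsKMMSolver H B bhat) {lam : ℝ}
    (hlam : 0 < lam) (h : H) {V : (Fin n → X × ℝ) × (Fin l → X) → ℝ}
    (hV : ∀ s, V s = (1 / (k : ℝ)) * ∑ j, bhat (fun j => (s.1 (e j)).1, s.2) j *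
        ((s.1 (e j)).2 - ridgeFit H lam (fun i => (s.1 (e' i)).1) (fun i => (s.1 (e' i)).2)
          (s.1 (e j)).1) +
      (1 / (l : ℝ)) * ∑ i, ridgeFit H lam (fun i => (s.1 (e' i)).1) (fun i => (s.1 (e' i)).2)
        (s.2 i)) :
    Measurable V ∧
    Integrable (fun s => (V s - targetMean μ' κ) ^ 2) (sampleLaw μ μ' κ n l) ∧
    ∫ s, (V s - targetMean μ' κ) ^ 2 ∂(sampleLaw μ μ' κ n l) ≤
      5 * (B ^ 2 / k + (2 * (((B + 1) * R) ^ 2 / k) + 2 * ((2 * R) ^ 2 / l)) / (4 * lam) +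
        (B ^ 2 + B) * ((1 + R ^ 2 / lam) ^ 2 *
          (∫ x, (h x - regressionFun κ x) ^ 2 ∂μ + lam / (m + 1) * ‖h‖ ^ 2)) + 1 / l) := by
  have hb : ∀ p j, bhat p j ∈ Icc 0 B := fun p j => (hbhat.2 p.1 p.2).1 j
  set G := regressionFun κ with hGdef
  have hG : Measurable G := measurable_regressionFun κ
  have hG01 : ∀ x, G x ∈ Icc (0 : ℝ) 1 := regressionFun_mem_Icc hκ
  have hG1 : ∀ x, |G x| ≤ 1 := fun x => by rw [abs_of_nonneg (hG01 x).1]; exact (hG01 x).2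
  have hp : ∀ i : Fin n, Measurable fun s : (Fin n → X × ℝ) × (Fin l → X) => s.1 i := fun i =>
    (measurable_pi_apply i).comp measurable_fst
  have hx : ∀ i : Fin n, Measurable fun s : (Fin n → X × ℝ) × (Fin l → X) => (s.1 i).1 := fun i =>
    measurable_fst.comp (hp i)
  have hy : ∀ i : Fin n, Measurable fun s : (Fin n → X × ℝ) × (Fin l → X) => (s.1 i).2 := fun i =>
    measurable_snd.comp (hp i)
  have hz : ∀ i : Fin l, Measurable fun s : (Fin n → X × ℝ) × (Fin l → X) => s.2 i := fun i =>
    (measurable_pi_apply i).comp measurable_snd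
  have hsel : Measurable fun s : (Fin n → X × ℝ) × (Fin l → X) =>
      ((fun j => (s.1 (e j)).1, s.2) : (Fin k → X) × (Fin l → X)) :=
    (measurable_pi_lambda _ fun j => hx _).prodMk measurable_snd
  have hVm : Measurable V := by
    have : V = _ := funext hV
    rw [this]
    refine Measurable.add (Measurable.const_mul (Finset.measurable_sum _ fun j _ => ?_) _)
      (Measurable.const_mul (Finset.measurable_sum _ fun i _ => ?_) _)
    · refine ((measurable_pi_apply j).comp (hbhat.1.comp hsel)).mul ((hy _).sub ?_)
      exact measurable_ridgeFit hK lam (measurable_pi_lambda _ fun i => hx _)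
        (measurable_pi_lambda _ fun i => hy _) (hx _)
    · exact measurable_ridgeFit hK lam (measurable_pi_lambda _ fun i => hx _)
        (measurable_pi_lambda _ fun i => hy _) (hz _)
  refine ⟨hVm, ?_⟩
  obtain ⟨i1, b1⟩ := integral_weighted_noise_sq_le hκ μ μ' (l := l) hk he hbhat.1 hb
  obtain ⟨i2, b2⟩ := integral_inner_ridgeFit_noise_sq_le hK hR hκ hbetam hbeta hd hk hl he he'
    hbhat hlam
  obtain ⟨-, i3, b3⟩ := integral_weighted_bias_sq_le hK hR κ μ μ' hG hG1 hk he' hdisj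
    hbhat.1 hb hlam
  obtain ⟨-, i4, b4⟩ := integral_test_bias_sq_le hK hR κ μ μ' hG hG1 hl he' hlam
  obtain ⟨i5, b5⟩ := integral_mean_sub_integral_sq_le μ' hG hG01 hl
  have hsnd : MeasurePreserving (Prod.snd : (Fin n → X × ℝ) × (Fin l → X) → _)
      (sampleLaw μ μ' κ n l) (Measure.pi fun _ => μ') := measurePreserving_snd
  have i5' := hsnd.integrable_comp_of_integrable i5
  have hmean : Measurable fun z : Fin l → X =>
      ((1 / (l : ℝ)) * ∑ i, G (z i) - ∫ x, G x ∂μ') ^ 2 :=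
    (((Finset.measurable_sum _ fun i _ => hG.comp (measurable_pi_apply i)).const_mul _).sub_const
      _).pow_const 2
  rw [← integral_comp_measurePreserving hsnd hmean] at b5
  have hE0 := integral_fitError_le hK hR μ hG hG1 hlam m h
  have hE1 := integral_fitError_test_le hK hR hbeta hd hG hG1 hlam m
  set E := (1 + R ^ 2 / lam) ^ 2 * (∫ x, (h x - G x) ^ 2 ∂μ + lam / (m + 1) * ‖h‖ ^ 2)
  have b3' := b3.trans (mul_le_mul_of_nonneg_left hE0 (sq_nonneg B))
  have b4' := b4.trans (hE1.trans (mul_le_mul_of_nonneg_left hE0 hB0))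
  rw [targetMean_eq hκ, ← hGdef]
  -- Weighted noise, noise of the fit paired with the discrepancy, weighted bias, test bias, and
  -- sampling error of the test mean of `G`.
  have hdec : ∀ s, V s - ∫ x, G x ∂μ' =
      (1 / (k : ℝ)) * ∑ j, bhat (fun j => (s.1 (e j)).1, s.2) j * noise κ (s.1 (e j)) +
      -(inner ℝ (meanDiscrepancy H bhat (fun j => (s.1 (e j)).1, s.2))
        (ridgeFit H lam (fun j => (s.1 (e' j)).1) (fun j => noise κ (s.1 (e' j)))) : ℝ) +
      (1 / (k : ℝ)) * ∑ j, bhat (fun j => (s.1 (e j)).1, s.2) j * (G (s.1 (e j)).1 -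
        ridgeFit H lam (fun i => (s.1 (e' i)).1) (fun i => G (s.1 (e' i)).1) (s.1 (e j)).1) +
      (1 / (l : ℝ)) * ∑ i,
        (ridgeFit H lam (fun i => (s.1 (e' i)).1) (fun i => G (s.1 (e' i)).1) (s.2 i) -
          G (s.2 i)) +
      ((1 / (l : ℝ)) * ∑ i, G (s.2 i) - ∫ x, G x ∂μ') := fun s => by
    have hsplit : ridgeFit H lam (fun i => (s.1 (e' i)).1) (fun i => (s.1 (e' i)).2) =
        ridgeFit H lam (fun i => (s.1 (e' i)).1) (fun i => G (s.1 (e' i)).1) +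
        ridgeFit H lam (fun i => (s.1 (e' i)).1) (fun i => noise κ (s.1 (e' i))) := by
      rw [← ridgeFit_add]
      congr 1
      funext i
      simp [noise, hGdef]
    rw [hV, hsplit, inner_meanDiscrepancy]
    set f := ridgeFit H lam (fun i => (s.1 (e' i)).1) (fun i => G (s.1 (e' i)).1)
    set f' := ridgeFit H lam (fun i => (s.1 (e' i)).1) (fun i => noise κ (s.1 (e' i)))
    have hy2 : ∀ j, (s.1 (e j)).2 = noise κ (s.1 (e j)) + G (s.1 (e j)).1 := fun j => by
      simp [noise, hGdef]
    simp only [RKHS.coe_add, Pi.add_apply, hy2, mul_add, mul_sub, Finset.sum_add_distrib,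
      Finset.sum_sub_distrib]
    ring
  have hfin := integral_add_five_sq_le (W := fun s => V s - ∫ x, G x ∂μ') (hVm.sub_const _)
    i1 (by simpa only [neg_sq] using i2) i3 i4 i5' b1 (by simpa only [neg_sq] using b2) b3' b4' b5
    hdec
  refine ⟨hfin.1, hfin.2.trans (le_of_eq ?_)⟩
  ring

end ErrorBound

/-! ### From mean square bounds to rates. -/

section Rates

variable {X : Type*} [MeasurableSpace X]

lemma nonneg_of_rnDeriv_le {μtr μte : Measure X} [IsProbabilityMeasure μtr]
    [IsProbabilityMeasure μte] (hac : μte ≪ μtr) {B : ℝ}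
    (hB : ∀ᵐ x ∂μtr, μte.rnDeriv μtr x ≤ ENNReal.ofReal B) : 0 ≤ B := by
  by_contra hneg
  have h1 : ∫⁻ x, μte.rnDeriv μtr x ∂μtr = 0 := by
    refine lintegral_eq_zero_of_ae_eq_zero ?_
    filter_upwards [hB] with x hx
    rw [ENNReal.ofReal_of_nonpos (not_le.1 hneg).le] at hx
    exact le_antisymm hx zero_le
  rw [Measure.lintegral_rnDeriv hac, measure_univ] at h1
  exact one_ne_zero h1

variable {H : Type*} [NormedAddCommGroup H] [InnerProductSpace ℝ H] [CompleteSpace H]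
  [RKHS ℝ H X ℝ]

/-- The mean squared error of the robust estimator, for regularization at least `1 / ntr`. -/
lemma exists_robustEstimator_meanSq_bound
    (hK : Measurable (Function.uncurry (kernelFun H : X → X → ℝ)))
    {R : ℝ} (hR : ∀ x : X, ‖featureMap H x‖ ≤ R) (μtr μte : Measure X) [IsProbabilityMeasure μtr]
    [IsProbabilityMeasure μte] (κ : Kernel X ℝ) [IsMarkovKernel κ]
    (hκ : ∀ x, ∀ᵐ y ∂(κ x), y ∈ Icc (0 : ℝ) 1) (hac : μte ≪ μtr) {B : ℝ}
    (hB : ∀ᵐ x ∂μtr, μte.rnDeriv μtr x ≤ ENNReal.ofReal B) {r : ℝ} (hr : 0 < r) (hr2 : r < 1 / 2)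
    (hg : ∃ g ∈ fracPowRange (integralOperator hK (abs_kernelFun_le H hR) μtr) r,
      (g : X → ℝ) =ᵐ[μtr] regressionFun κ)
    {ρ : ℝ} (hρ0 : 0 < ρ) (hρ1 : ρ < 1) :
    ∃ C : ℝ, 0 ≤ C ∧ ∀ (ntr nte : ℕ) (γ : ℝ), 1 ≤ ⌊ρ * ntr⌋₊ → 1 ≤ nte → (ntr : ℝ)⁻¹ ≤ γ →
      ∀ bhat : (Fin ⌊ρ * ntr⌋₊ → X) × (Fin nte → X) → Fin ⌊ρ * ntr⌋₊ → ℝ, IsKMMSolver H B bhat →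
      ∀ ghat : (Fin (ntr - ⌊ρ * ntr⌋₊) → X × ℝ) → H, (∀ d, IsRegularizedLS γ d (ghat d)) →
      Measurable (robustEstimator hρ1.le bhat ghat) ∧
      Integrable (fun s => (robustEstimator hρ1.le bhat ghat s - targetMean μte κ) ^ 2)
        (sampleLaw μtr μte κ ntr nte) ∧
      ∫ s, (robustEstimator hρ1.le bhat ghat s - targetMean μte κ) ^ 2
          ∂(sampleLaw μtr μte κ ntr nte) ≤
        C * (γ ^ (2 * r) + (ntr : ℝ)⁻¹ + (nte : ℝ)⁻¹) := by
  have hB0 : 0 ≤ B := nonneg_of_rnDeriv_le hac hB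
  obtain ⟨b, hbm, hb, hd⟩ := exists_bounded_density hac hB0 hB
  obtain ⟨A, hA0, hA⟩ := exists_rkhs_approx hK hR μtr hr hr2 hg
  set c := 1 - ρ with hc
  have hc0 : 0 < c := by linarith
  refine ⟨5 * (B ^ 2 * (2 / ρ) + (2 * (((B + 1) * R) ^ 2 * (2 / ρ)) + 2 * (2 * R) ^ 2) / (4 * c) +
    (B ^ 2 + B) * ((1 + R ^ 2 / c) ^ 2 * A) + 1), by positivity, ?_⟩
  intro n l γ hk hl hγ
  have hn : 0 < n := by
    rcases Nat.eq_zero_or_pos n with h | h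
    · subst h; simp at hk
    · exact h
  have hn' : (0 : ℝ) < n := Nat.cast_pos.2 hn
  have hl' : (0 : ℝ) < l := Nat.cast_pos.2 hl
  have hγ0 : 0 < γ := (inv_pos.2 hn').trans_le hγ
  have hkn : ⌊ρ * n⌋₊ < n := by
    have : (⌊ρ * n⌋₊ : ℝ) < n := (Nat.floor_le (by positivity)).trans_lt (by nlinarith)
    exact_mod_cast this
  set k := ⌊ρ * n⌋₊ with hkdef
  have hk' : (0 : ℝ) < k := Nat.cast_pos.2 hk
  set m := n - k with hm
  have hm0 : 0 < m := Nat.sub_pos_of_lt hkn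
  have hm' : (0 : ℝ) < m := Nat.cast_pos.2 hm0
  have hmn : c * n ≤ m := by
    rw [hm, Nat.cast_sub hkn.le, hc]
    have : (k : ℝ) ≤ ρ * n := Nat.floor_le (by positivity)
    linarith
  -- Since `k ≥ 1`, `ρ n < k + 1 ≤ 2k`.
  have hkinv : (k : ℝ)⁻¹ ≤ 2 / ρ * (n : ℝ)⁻¹ := by
    have h1 : ρ * n < k + 1 := Nat.lt_floor_add_one _
    have h2 : (1 : ℝ) ≤ k := by exact_mod_cast hk
    rw [← div_eq_mul_inv, div_div, ← one_div, div_le_div_iff₀ hk' (by positivity)]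
    linarith
  set lam := (m : ℝ) * γ with hlamdef
  -- The only use of `γ ≥ 1/n`: the unnormalized parameter stays away from `0`, which keeps the
  -- leave-one-out and noise factors bounded.
  have hlamc : c ≤ lam := by
    calc c = c * n * (n : ℝ)⁻¹ := by field_simp
      _ ≤ m * γ := mul_le_mul hmn hγ (by positivity) hm'.le
  have hlam : 0 < lam := hc0.trans_le hlamc
  have hlamm : lam / (m + 1) ≤ γ := by
    rw [div_le_iff₀ (by positivity), hlamdef]
    nlinarith
  obtain ⟨h, hh⟩ := hA γ hγ0
  let e : Fin k → Fin n := fun j => ⟨j, j.2.trans hkn⟩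
  let e' : Fin m → Fin n := fun j => ⟨k + j, Nat.add_lt_of_lt_sub' j.2⟩
  have he : Function.Injective e := fun i j hij => by
    have := congrArg Fin.val hij; exact Fin.ext this
  have he' : Function.Injective e' := fun i j hij => by
    have := congrArg Fin.val hij
    simp only [e'] at this
    exact Fin.ext (by omega)
  have hdisj : ∀ j i, e j ≠ e' i := fun j i hij => by
    have := congrArg Fin.val hij
    simp only [e, e'] at this
    have := j.2
    omega
  intro bhat hbhat ghat hghat
  -- Uniqueness of the minimizer identifies `ghat` with the explicit fit, which also yields the
  -- measurability of the estimator.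
  have hgh : ∀ d, ghat d = ridgeFit H lam (fun j => (d j).1) (fun j => (d j).2) := fun d =>
    (hghat d).eq_ridgeFit hγ0 hm0
  obtain ⟨hVm, hVi, hVb⟩ := integral_estimator_sub_sq_le hK hR hκ hB0 hbm hb hd hk hl he he' hdisj
    hbhat hlam h (V := robustEstimator hρ1.le bhat ghat) (fun s => by
      simp only [robustEstimator, hgh]
      rfl)
  refine ⟨hVm, hVi, hVb.trans ?_⟩
  have hγr : 0 ≤ γ ^ (2 * r) := Real.rpow_nonneg hγ0.le _
  have hS : (1 + R ^ 2 / lam) ^ 2 ≤ (1 + R ^ 2 / c) ^ 2 := by gcongr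
  have hE : ∫ x, (h x - regressionFun κ x) ^ 2 ∂μtr + lam / (m + 1) * ‖h‖ ^ 2 ≤ A * γ ^ (2 * r) :=
    le_trans (by gcongr) hh
  have h1 : B ^ 2 / k ≤ B ^ 2 * (2 / ρ) * (n : ℝ)⁻¹ := by
    rw [div_eq_mul_inv, mul_assoc]; gcongr
  have h2 : (2 * (((B + 1) * R) ^ 2 / k) + 2 * ((2 * R) ^ 2 / l)) / (4 * lam) ≤
      (2 * (((B + 1) * R) ^ 2 * (2 / ρ)) + 2 * (2 * R) ^ 2) / (4 * c) *
        ((n : ℝ)⁻¹ + (l : ℝ)⁻¹) := by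
    rw [div_mul_eq_mul_div]
    refine div_le_div₀ (by positivity) ?_ (by positivity) (by linarith)
    have h3 : ((B + 1) * R) ^ 2 / k ≤ ((B + 1) * R) ^ 2 * (2 / ρ) * (n : ℝ)⁻¹ := by
      rw [div_eq_mul_inv, mul_assoc]; gcongr
    have h4 : 0 ≤ ((B + 1) * R) ^ 2 * (2 / ρ) * (l : ℝ)⁻¹ := by positivity
    have h5 : 0 ≤ (2 * R) ^ 2 * (n : ℝ)⁻¹ := by positivity
    rw [div_eq_mul_inv ((2 * R) ^ 2)]
    linarith
  have h3 : (B ^ 2 + B) * ((1 + R ^ 2 / lam) ^ 2 *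
      (∫ x, (h x - regressionFun κ x) ^ 2 ∂μtr + lam / (m + 1) * ‖h‖ ^ 2)) ≤
      (B ^ 2 + B) * ((1 + R ^ 2 / c) ^ 2 * A) * γ ^ (2 * r) := by
    rw [mul_assoc, mul_assoc]
    refine mul_le_mul_of_nonneg_left ?_ (by positivity)
    exact mul_le_mul hS hE (add_nonneg (integral_nonneg fun x => sq_nonneg _) (by positivity))
      (by positivity)
  have h4 : 1 / (l : ℝ) = (l : ℝ)⁻¹ := one_div _
  have hni : 0 < (n : ℝ)⁻¹ := by positivity
  have hli : 0 < (l : ℝ)⁻¹ := by positivity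
  set K1 := B ^ 2 * (2 / ρ)
  set K2 := (2 * (((B + 1) * R) ^ 2 * (2 / ρ)) + 2 * (2 * R) ^ 2) / (4 * c)
  set K3 := (B ^ 2 + B) * ((1 + R ^ 2 / c) ^ 2 * A)
  have hK1 : 0 ≤ K1 := by positivity
  have hK2 : 0 ≤ K2 := by positivity
  have hK3 : 0 ≤ K3 := by positivity
  rw [h4, mul_assoc]
  refine mul_le_mul_of_nonneg_left ?_ (by norm_num)
  have p1 := mul_nonneg hK1 (add_nonneg hγr hli.le)
  have p2 := mul_nonneg hK2 hγr
  have p3 := mul_nonneg hK3 (add_nonneg hni.le hli.le)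
  linarith

/-- Integrates the pointwise bound `|W| ≤ (W² + S²)/(2S)`. -/
lemma integral_abs_le_of_integral_sq_le {Ω : Type*} [MeasurableSpace Ω] {P : Measure Ω}
    [IsProbabilityMeasure P] {W : Ω → ℝ} (hW : Measurable W)
    (hi : Integrable (fun s => W s ^ 2) P) {S : ℝ} (hS : 0 < S) (hb : ∫ s, W s ^ 2 ∂P ≤ S ^ 2) :
    Integrable (fun s => |W s|) P ∧ ∫ s, |W s| ∂P ≤ S := by
  have hle : ∀ s, |W s| ≤ (W s ^ 2 + S ^ 2) * (1 / (2 * S)) := fun s => by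
    rw [mul_one_div, le_div_iff₀ (by positivity), ← sq_abs (W s)]
    nlinarith [sq_nonneg (|W s| - S)]
  have hgi : Integrable (fun s => (W s ^ 2 + S ^ 2) * (1 / (2 * S))) P :=
    (hi.add (integrable_const _)).mul_const _
  have hWi : Integrable (fun s => |W s|) P :=
    hgi.mono' hW.norm.aestronglyMeasurable
      (Filter.Eventually.of_forall fun s => by rw [Real.norm_eq_abs, abs_abs]; exact hle s)
  refine ⟨hWi, (integral_mono hWi hgi hle).trans ?_⟩
  rw [integral_mul_const, integral_add hi (integrable_const _)]
  simp only [integral_const, probReal_univ, one_smul]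
  rw [mul_one_div, div_le_iff₀ (by positivity)]
  nlinarith

lemma rates_of_meanSq_bound {μtr μte : Measure X} [IsProbabilityMeasure μtr]
    [IsProbabilityMeasure μte] {κ : Kernel X ℝ} [IsMarkovKernel κ] {B ρ : ℝ} (hρ1 : ρ ≤ 1)
    {reg rate : ℕ → ℕ → ℝ} (hrate : ∀ n l : ℕ, 1 ≤ n → 1 ≤ l → 0 < rate n l) {C : ℝ} (hC : 0 ≤ C)
    (hbound : ∀ ntr nte : ℕ, 1 ≤ ⌊ρ * ntr⌋₊ → 1 ≤ nte →
      ∀ bhat : (Fin ⌊ρ * ntr⌋₊ → X) × (Fin nte → X) → Fin ⌊ρ * ntr⌋₊ → ℝ, IsKMMSolver H B bhat →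
      ∀ ghat : (Fin (ntr - ⌊ρ * ntr⌋₊) → X × ℝ) → H,
        (∀ d, IsRegularizedLS (reg ntr nte) d (ghat d)) →
      Measurable (robustEstimator hρ1 bhat ghat) ∧
      Integrable (fun s => (robustEstimator hρ1 bhat ghat s - targetMean μte κ) ^ 2)
        (sampleLaw μtr μte κ ntr nte) ∧
      ∫ s, (robustEstimator hρ1 bhat ghat s - targetMean μte κ) ^ 2
          ∂(sampleLaw μtr μte κ ntr nte) ≤ C * rate ntr nte ^ 2) :
    RateInExpectation H μtr μte κ B hρ1 reg rate ∧
      RateInProbability H μtr μte κ B hρ1 reg rate := by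
  have hpos : ∀ n : ℕ, 1 ≤ ⌊ρ * n⌋₊ → 1 ≤ n := fun n hk => by
    rcases Nat.eq_zero_or_pos n with h | h
    · subst h; simp at hk
    · exact h
  have hprob : ∀ n l, IsProbabilityMeasure (sampleLaw μtr μte κ n l) := fun n l => by
    unfold sampleLaw; infer_instance
  -- The added `1` keeps `D` positive when `C = 0`.
  set D := √C + 1 with hD
  have hD0 : 0 < D := by positivity
  have hCD : C ≤ D ^ 2 := by
    have := Real.sq_sqrt hC
    have := Real.sqrt_nonneg C
    nlinarith
  have hmain : ∀ ntr nte : ℕ, 1 ≤ ⌊ρ * ntr⌋₊ → 1 ≤ nte →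
      ∀ bhat : (Fin ⌊ρ * ntr⌋₊ → X) × (Fin nte → X) → Fin ⌊ρ * ntr⌋₊ → ℝ, IsKMMSolver H B bhat →
      ∀ ghat : (Fin (ntr - ⌊ρ * ntr⌋₊) → X × ℝ) → H,
        (∀ d, IsRegularizedLS (reg ntr nte) d (ghat d)) →
      Integrable (fun s => |robustEstimator hρ1 bhat ghat s - targetMean μte κ|)
          (sampleLaw μtr μte κ ntr nte) ∧
        ∫ s, |robustEstimator hρ1 bhat ghat s - targetMean μte κ| ∂(sampleLaw μtr μte κ ntr nte)
          ≤ D * rate ntr nte := fun n l hk hl bhat hbhat ghat hghat => by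
    have := hprob n l
    obtain ⟨hm, hi, hb⟩ := hbound n l hk hl bhat hbhat ghat hghat
    refine integral_abs_le_of_integral_sq_le (hm.sub_const _) hi
      (mul_pos hD0 (hrate n l (hpos n hk) hl)) (hb.trans ?_)
    rw [mul_pow]
    exact mul_le_mul_of_nonneg_right hCD (sq_nonneg _)
  refine ⟨⟨D, hmain⟩, fun δ hδ0 _ => ⟨D / δ, fun n l hk hl bhat hbhat ghat hghat => ?_⟩⟩
  have := hprob n l
  obtain ⟨hi, hb⟩ := hmain n l hk hl bhat hbhat ghat hghat
  have hr0 := hrate n l (hpos n hk) hl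
  -- Markov's inequality at level `(D/δ) * rate`, for a mean of at most `D * rate`.
  have hmk := mul_meas_ge_le_integral_of_nonneg (Filter.Eventually.of_forall fun s => abs_nonneg _)
    hi (D / δ * rate n l)
  have hle : (sampleLaw μtr μte κ n l).real
      {s | D / δ * rate n l ≤ |robustEstimator hρ1 bhat ghat s - targetMean μte κ|} ≤ δ := by
    refine le_of_mul_le_mul_left (hmk.trans (hb.trans (le_of_eq ?_)))
      (show 0 < D / δ * rate n l by positivity)
    field_simp
  refine (measure_mono fun s hs => ?_).trans
    ((ENNReal.le_ofReal_iff_toReal_le (measure_ne_top _ _) hδ0.le).2 hle)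
  have hs' : D / δ * rate n l < |robustEstimator hρ1 bhat ghat s - targetMean μte κ| := hs
  exact hs'.le

lemma inv_le_rpow_neg_sq {n : ℕ} (hn : 1 ≤ n) {r : ℝ} (hr2 : r ≤ 1 / 2) :
    (n : ℝ)⁻¹ ≤ ((n : ℝ) ^ (-r)) ^ 2 := by
  have hn' : (1 : ℝ) ≤ n := by exact_mod_cast hn
  rw [← Real.rpow_natCast, ← Real.rpow_mul (by positivity), ← Real.rpow_neg_one]
  exact Real.rpow_le_rpow_of_exponent_le hn' (by push_cast; linarith)

lemma inv_rpow_two_mul (n : ℕ) (r : ℝ) : ((n : ℝ)⁻¹) ^ (2 * r) = ((n : ℝ) ^ (-r)) ^ 2 := by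
  rw [← Real.rpow_natCast, ← Real.rpow_mul (by positivity), Real.inv_rpow (by positivity),
    ← Real.rpow_neg (by positivity)]
  congr 1
  push_cast
  ring

end Rates

end CovariateShift

/-! ### The two choices of the regularization parameter. -/

theorem corollary1
    {X : Type*} [TopologicalSpace X] [CompactSpace X] [MeasurableSpace X] [BorelSpace X]
    {H : Type*} [NormedAddCommGroup H] [InnerProductSpace ℝ H] [CompleteSpace H] [RKHS ℝ H X ℝ]
    (hK : Measurable (Function.uncurry (CovariateShift.kernelFun H : X → X → ℝ)))
    {R : ℝ} (hR : ∀ x : X, ‖CovariateShift.featureMap H x‖ ≤ R)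
    (μtr μte : Measure X) [IsProbabilityMeasure μtr] [IsProbabilityMeasure μte]
    (κ : Kernel X ℝ) [IsMarkovKernel κ] (hκ : ∀ x, ∀ᵐ y ∂(κ x), y ∈ Icc (0 : ℝ) 1)
    (hac : μte ≪ μtr) {B : ℝ} (hB : ∀ᵐ x ∂μtr, μte.rnDeriv μtr x ≤ ENNReal.ofReal B)
    {θ : ℝ} (hθ : 0 < θ)
    (hg : ∃ g ∈ CovariateShift.fracPowRange
        (CovariateShift.integralOperator hK (CovariateShift.abs_kernelFun_le H hR) μtr)
        (θ / (2 * θ + 4)),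
      (g : X → ℝ) =ᵐ[μtr] CovariateShift.regressionFun κ)
    {ρ : ℝ} (hρ0 : 0 < ρ) (hρ1 : ρ < 1) :
    (CovariateShift.RateInExpectation H μtr μte κ B hρ1.le
        (fun ntr nte => ((min ntr nte : ℕ) : ℝ)⁻¹)
        (fun ntr nte => (ntr : ℝ) ^ (-(θ / (2 * θ + 4))) + (nte : ℝ) ^ (-(θ / (2 * θ + 4)))) ∧
      CovariateShift.RateInProbability H μtr μte κ B hρ1.le
        (fun ntr nte => ((min ntr nte : ℕ) : ℝ)⁻¹)
        (fun ntr nte => (ntr : ℝ) ^ (-(θ / (2 * θ + 4))) + (nte : ℝ) ^ (-(θ / (2 * θ + 4))))) ∧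
    (CovariateShift.RateInExpectation H μtr μte κ B hρ1.le
        (fun ntr _ => (ntr : ℝ)⁻¹)
        (fun ntr nte => (ntr : ℝ) ^ (-(θ / (2 * θ + 4))) + (nte : ℝ) ^ (-(1 / 2 : ℝ))) ∧
      CovariateShift.RateInProbability H μtr μte κ B hρ1.le
        (fun ntr _ => (ntr : ℝ)⁻¹)
        (fun ntr nte => (ntr : ℝ) ^ (-(θ / (2 * θ + 4))) + (nte : ℝ) ^ (-(1 / 2 : ℝ)))) := by
  set r := θ / (2 * θ + 4) with hrdef
  have hr : 0 < r := by positivity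
  have hr2 : r < 1 / 2 := by
    rw [hrdef, div_lt_div_iff₀ (by positivity) (by norm_num)]
    linarith
  obtain ⟨C, hC0, hC⟩ := CovariateShift.exists_robustEstimator_meanSq_bound hK hR μtr μte κ hκ hac
    hB hr hr2 hg hρ0 hρ1
  have hpos : ∀ n : ℕ, 1 ≤ ⌊ρ * n⌋₊ → 1 ≤ n := fun n hk => by
    rcases Nat.eq_zero_or_pos n with h | h
    · subst h; simp at hk
    · exact h
  have hp : ∀ (n : ℕ) (a : ℝ), 1 ≤ n → 0 < (n : ℝ) ^ a := fun n a hn =>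
    Real.rpow_pos_of_pos (Nat.cast_pos.2 hn) a
  constructor
  · refine CovariateShift.rates_of_meanSq_bound hρ1.le
      (fun n l hn hl => add_pos (hp n _ hn) (hp l _ hl)) (C := C * 2) (by positivity) ?_
    intro n l hk hl bhat hbhat ghat hghat
    have hn := hpos n hk
    have hn' : (0 : ℝ) < n := Nat.cast_pos.2 hn
    have hmin : (n : ℝ)⁻¹ ≤ ((min n l : ℕ) : ℝ)⁻¹ :=
      inv_anti₀ (Nat.cast_pos.2 (lt_min hn hl)) (Nat.cast_le.2 (min_le_left n l))
    obtain ⟨hm, hi, hb⟩ := hC n l _ hk hl hmin bhat hbhat ghat hghat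
    refine ⟨hm, hi, hb.trans ?_⟩
    rw [mul_assoc]
    refine mul_le_mul_of_nonneg_left ?_ hC0
    have h1 := CovariateShift.inv_le_rpow_neg_sq hn hr2.le
    have h2 := CovariateShift.inv_le_rpow_neg_sq hl hr2.le
    -- The minimum is one of the two sample sizes, so its power is one of the two summands.
    have h3 : (((min n l : ℕ) : ℝ)⁻¹) ^ (2 * r) ≤
        ((n : ℝ) ^ (-r)) ^ 2 + ((l : ℝ) ^ (-r)) ^ 2 := by
      rw [CovariateShift.inv_rpow_two_mul]
      rcases min_choice n l with h | h <;> rw [h]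
      · linarith [sq_nonneg ((l : ℝ) ^ (-r))]
      · linarith [sq_nonneg ((n : ℝ) ^ (-r))]
    nlinarith [mul_pos (hp n (-r) hn) (hp l (-r) hl)]
  · refine CovariateShift.rates_of_meanSq_bound hρ1.le
      (fun n l hn hl => add_pos (hp n _ hn) (hp l _ hl)) (C := C * 2) (by positivity) ?_
    intro n l hk hl bhat hbhat ghat hghat
    have hn := hpos n hk
    obtain ⟨hm, hi, hb⟩ := hC n l _ hk hl le_rfl bhat hbhat ghat hghat
    refine ⟨hm, hi, hb.trans ?_⟩
    rw [mul_assoc]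
    refine mul_le_mul_of_nonneg_left ?_ hC0
    have h1 := CovariateShift.inv_le_rpow_neg_sq hn hr2.le
    -- With `γ = 1/n` the regularization bias no longer involves the test size `l`, which
    -- contributes only `1/l`, the square of `l^(-1/2)`.
    have h2 := CovariateShift.inv_le_rpow_neg_sq hl le_rfl
    rw [CovariateShift.inv_rpow_two_mul]
    nlinarith [mul_pos (hp n (-r) hn) (hp l (-(1 / 2)) hl), sq_nonneg ((l : ℝ) ^ (-(1 / 2 : ℝ)))]
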